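/- **Setting.** Let $T,\tau>0$. For $i=1,2$ consider the control system $0=F_i(t,z_i,\dot z_i,u_i)$ with output $y_i=G_i(t,z_i)$, where $z_i\in\mathbb R^{n_i}$, $u_1,y_2\in\mathbb R^{m_1}$, $u_2,y_1\in\mathbb R^{m_2}$. Let $F_i$ be $\mathbb R^{n_i}$-valued and smooth ($C^\infty$) on $[0,T]\times\mathbb D_{z_i}\times\mathbb D_{\dot z_i}\times\mathbb D_{u_i}$ with open sets $\mathbb D_{z_i},\mathbb D_{\dot z_i},\mathbb D_{u_i}$. Let $G_1:[0,T]\times\mathbb D_{z_1}\to\mathbb D_{u_2}$ and $G_2:[-\tau,T]\times\mathbb D_{z_2}\to\mathbb D_{u_1}$ be smooth. (Smooth on a product with a compact time interval means that near each point there is a smooth extension across the end points.) **Derivative array.** For a system $0=F(t,z,\dot z,u)$ with $z\in\mathbb R^n$, $u\in\mathbb R^m$ and $k\ge 0$ let $$\mathcal D_k(t,z,\eta,u,\dot u,\dots,u^{(k)})=\big[F;\tfrac{d}{dt}F;\dots;(\tfrac{d}{dt})^kF\big],\qquad \eta=[\dot z;\dots;z^{(k+1)}],$$ be the derivative array of level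 $k$, regarded as a function of the independent variables $t,z,\eta,u,\dots,u^{(k)}$, and let $\mathcal M_k$ be its zero set, with $t\in[0,T]$ and $z,\dot z,u$ in their domains. Call the system *consistent at level $k$* if for every smooth control $u:[0,T]\to\mathbb D_u$ there are $t,z,\eta$ with $(t,z,\eta,u(t),\dots,u^{(k)}(t))\in\mathcal M_k$. **Strangeness hypothesis at level $\mu$.** The system is consistent at level $\mu$, and there are integers $a,d\ge 0$ with $a+d=n$ and matrix functions $Z_A(\cdot)\in\mathbb R^{(\mu+1)n\times a}$, $T_A(\cdot),Z_D(\cdot)\in\mathbb R^{n\times d}$ such that every point of $\mathcal M_\mu$ has a neighbourhood $\mathcal U$ on which, at all points of $\mathcal M_\mu\cap\mathcal U$: $Z_A,T_A,Z_D$ have ranks $a,d,d$; 1. $\operatorname{rank}\partial_\eta\mathcal D_\mu=(\mu+1)n-a$ and $Z_A^T\partial_\eta\mathcal D_\mu=0$; 2. $\operatorname{rank}(Z_A^T\partial_z\mathcal D_\mu)=a$ and $Z_A^T(\partial_z\mathcal D_\mu)T_A=0$; 3. $\operatorname{rank}(\partial_{\dot z}F\,T_A)=d$ and $\operatorname{rank}(Z_D^T\,\partial_{\dot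 z}F\,T_A)=d$. **Differentiation index.** The system *determines $\dot z$ at level $k$* if for every $p_0\in\mathcal M_k$ there are a neighbourhood $\mathcal U$ of $p_0$ and a function $f$, smooth at the $(t,z,u,\dots,u^{(k)})$-part of $p_0$, such that $\dot z=f(t,z,u,\dots,u^{(k)})$ for all points of $\mathcal M_k\cap\mathcal U$. The differentiation index is the smallest $k$ with this property. **Shifted hybrid system.** This is $$0=\begin{bmatrix}F_1\big(t,z_1(t),\dot z_1(t),G_2(t-\tau,z_2(t-\tau))\big)\\ F_2\big(t,z_2(t),\dot z_2(t),G_1(t,z_1(t))\big)\end{bmatrix},\qquad z=[z_1;z_2].$$ Its consistency and its differentiation index are by definition those of the associated control system, obtained by replacing $z(t-\tau)$ by a control with values in $\mathbb D_{z_1}\times\mathbb D_{z_2}$. **Theorem.** If the two subsystems satisfy the strangeness hypothesis at levels $\mu_1$ and $\mu_2$, respectively, then the shifted hybrid system has a (well-defined) differentiation index, and that index is at most $\mu_1+\mu_2+1$. If, moreover, each subsystem has, for every smooth control with values in its control domain, a smooth solution on $[0,T]$, then the shifted hybrid system is consistent at every level $k$, so the index does not arise from an empty zero set. -/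

import Mathlib

open Set Topology
open scoped ContDiff Nat

namespace HybridDAE

/-- A (control) differential-algebraic system `0 = F(t, z, ż, u)`: the function `F` together with
the domains of the state `z`, of the derivative `ż` and of the control `u`.  Only the values of `F`
for `t` in the time interval and `(z, ż, u)` in the domains matter. -/
structure ControlDAE (ι κ : Type*) where
  /-- the right-hand side `F(t, z, ż, u)` -/
  F : ℝ → (ι → ℝ) → (ι → ℝ) → (κ → ℝ) → (ι → ℝ)
  /-- domain of the state -/
  domZ : Set (ι → ℝ)
  /-- domain of the derivative of the state -/
  domV : Set (ι → ℝ)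
  /-- domain of the control -/
  domU : Set (κ → ℝ)

/-- The curve `s ↦ ∑ⱼ (s - t)ʲ / j! • c j`, whose derivatives at time `t` are `c 0, c 1, …`. -/
noncomputable def jetCurve {V : Type*} [AddCommGroup V] [Module ℝ V] {k : ℕ}
    (t : ℝ) (c : Fin k → V) (s : ℝ) : V :=
  ∑ j : Fin k, ((s - t) ^ (j : ℕ) / ((j : ℕ)! : ℝ)) • c j

/-- The variables `(t, z, η, (u, u̇, …, u⁽ᵏ⁾))` with `η = (ż, …, z⁽ᵏ⁺¹⁾)` of the derivative array of
level `k`. -/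
abbrev JetSpace (ι κ : Type*) (k : ℕ) : Type _ :=
  ℝ × (ι → ℝ) × (Fin (k + 1) → ι → ℝ) × (Fin (k + 1) → κ → ℝ)

namespace ControlDAE

variable {ι κ : Type*} [Fintype ι] [Fintype κ]

/-- The data of a system on the time interval `[0, T]`: open domains and `F` smooth
on `[0, T] × domZ × domV × domU` (smooth up to the end points of the time interval). -/
def IsSmooth (T : ℝ) (S : ControlDAE ι κ) : Prop :=
  IsOpen S.domZ ∧ IsOpen S.domV ∧ IsOpen S.domU ∧
    ∀ t ∈ Icc (0 : ℝ) T, ∀ z ∈ S.domZ, ∀ v ∈ S.domV, ∀ u ∈ S.domU,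
      ContDiffAt ℝ ∞
        (fun q : ℝ × (ι → ℝ) × (ι → ℝ) × (κ → ℝ) => S.F q.1 q.2.1 q.2.2.1 q.2.2.2) (t, z, v, u)

/-- A control that is smooth on `[0, T]` and takes values in the control domain. -/
def IsControl (T : ℝ) (S : ControlDAE ι κ) (u : ℝ → κ → ℝ) : Prop :=
  ∀ t ∈ Icc (0 : ℝ) T, ContDiffAt ℝ ∞ u t ∧ u t ∈ S.domU

/-- The derivative array of level `k`: its block `i` is `(d/dt)ⁱ F(t, z, ż, u)`, written as a function
of `t, z, η = (ż, …, z⁽ᵏ⁺¹⁾)` and `υ = (u, …, u⁽ᵏ⁾)`.  The total derivative is evaluated along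
curves with the prescribed derivatives at time `t`. -/
noncomputable def derivArray (S : ControlDAE ι κ) (k : ℕ) (t : ℝ) (z : ι → ℝ)
    (η : Fin (k + 1) → ι → ℝ) (υ : Fin (k + 1) → κ → ℝ) : Fin (k + 1) → ι → ℝ :=
  fun i => iteratedDeriv (i : ℕ)
    (fun s => S.F s
      (jetCurve t (Fin.cons z η : Fin (k + 2) → ι → ℝ) s)
      (deriv (jetCurve t (Fin.cons z η : Fin (k + 2) → ι → ℝ)) s)
      (jetCurve t υ s)) t

/-- The zero set of the derivative array of level `k`. -/
def solSet (T : ℝ) (S : ControlDAE ι κ) (k : ℕ) : Set (JetSpace ι κ k) :=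
  {p | p.1 ∈ Icc (0 : ℝ) T ∧ p.2.1 ∈ S.domZ ∧ p.2.2.1 0 ∈ S.domV ∧ p.2.2.2 0 ∈ S.domU ∧
    S.derivArray k p.1 p.2.1 p.2.2.1 p.2.2.2 = 0}

/-- For every smooth control `u` the derivative array of level `k` has a zero whose control
components are `u(t), …, u⁽ᵏ⁾(t)`. -/
def IsConsistentAt (T : ℝ) (S : ControlDAE ι κ) (k : ℕ) : Prop :=
  ∀ u : ℝ → κ → ℝ, S.IsControl T u →
    ∃ (t : ℝ) (z : ι → ℝ) (η : Fin (k + 1) → ι → ℝ),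
      ((t, z, η, fun i => iteratedDeriv (i : ℕ) u t) : JetSpace ι κ k) ∈ S.solSet T k

open Classical in
/-- The Jacobian of the derivative array with respect to `η = (ż, …, z⁽ᵏ⁺¹⁾)`. -/
noncomputable def jacEta (S : ControlDAE ι κ) (k : ℕ) (p : JetSpace ι κ k) :
    Matrix (Fin (k + 1) × ι) (Fin (k + 1) × ι) ℝ :=
  Matrix.of fun i j =>
    fderiv ℝ (fun η => S.derivArray k p.1 p.2.1 η p.2.2.2) p.2.2.1
      (Pi.single j.1 (Pi.single j.2 1)) i.1 i.2

open Classical in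
/-- The Jacobian of the derivative array with respect to `z`. -/
noncomputable def jacZ (S : ControlDAE ι κ) (k : ℕ) (p : JetSpace ι κ k) :
    Matrix (Fin (k + 1) × ι) ι ℝ :=
  Matrix.of fun i j =>
    fderiv ℝ (fun z => S.derivArray k p.1 z p.2.2.1 p.2.2.2) p.2.1 (Pi.single j 1) i.1 i.2

open Classical in
/-- The Jacobian `∂F/∂ż`. -/
noncomputable def jacV (S : ControlDAE ι κ) (k : ℕ) (p : JetSpace ι κ k) : Matrix ι ι ℝ :=
  Matrix.of fun i j =>
    fderiv ℝ (fun v => S.F p.1 p.2.1 v (p.2.2.2 0)) (p.2.2.1 0) (Pi.single j 1) i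

/-- The strangeness hypothesis for control systems with characteristic values `μ`, `a` and
`d = n - a`. -/
def StrangenessHypothesis (T : ℝ) (S : ControlDAE ι κ) (μ : ℕ) : Prop :=
  ∃ a d : ℕ, a + d = Fintype.card ι ∧
  ∃ (ZA : JetSpace ι κ μ → Matrix (Fin (μ + 1) × ι) (Fin a) ℝ)
    (TA : JetSpace ι κ μ → Matrix ι (Fin d) ℝ)
    (ZD : JetSpace ι κ μ → Matrix ι (Fin d) ℝ),
    S.IsConsistentAt T μ ∧
    ∀ p₀ ∈ S.solSet T μ, ∃ U ∈ 𝓝 p₀, ∀ p ∈ S.solSet T μ ∩ U,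
      ((ZA p).rank = a ∧ (TA p).rank = d ∧ (ZD p).rank = d) ∧
      ((S.jacEta μ p).rank + a = (μ + 1) * Fintype.card ι ∧
        (ZA p).transpose * S.jacEta μ p = 0) ∧
      (((ZA p).transpose * S.jacZ μ p).rank = a ∧
        (ZA p).transpose * S.jacZ μ p * TA p = 0) ∧
      ((S.jacV μ p * TA p).rank = d ∧
        ((ZD p).transpose * S.jacV μ p * TA p).rank = d)

/-- The system differentiated `k` times determines `ż`: near each zero of the derivative array of
level `k`, all zeros satisfy `ż = f(t, z, u, …, u⁽ᵏ⁾)` with a smooth function `f`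
(the underlying ordinary differential equation). -/
def DeterminesDerivative (T : ℝ) (S : ControlDAE ι κ) (k : ℕ) : Prop :=
  ∀ p₀ ∈ S.solSet T k, ∃ U ∈ 𝓝 p₀,
    ∃ f : ℝ × (ι → ℝ) × (Fin (k + 1) → κ → ℝ) → ι → ℝ,
      ContDiffAt ℝ ∞ f (p₀.1, p₀.2.1, p₀.2.2.2) ∧
      ∀ p ∈ S.solSet T k ∩ U, p.2.2.1 0 = f (p.1, p.2.1, p.2.2.2)

/-- The differentiation index: the minimal number of differentiations after which `ż` is
determined as a function of `t`, `z` and the control with its derivatives. -/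
def HasDifferentiationIndex (T : ℝ) (S : ControlDAE ι κ) (ν : ℕ) : Prop :=
  IsLeast {k | S.DeterminesDerivative T k} ν

/-- For every smooth control the system has a smooth solution on `[0, T]`. -/
def IsSolvable (T : ℝ) (S : ControlDAE ι κ) : Prop :=
  ∀ u : ℝ → κ → ℝ, S.IsControl T u →
    ∃ z : ℝ → ι → ℝ, ∀ t ∈ Icc (0 : ℝ) T,
      ContDiffAt ℝ ∞ z t ∧ z t ∈ S.domZ ∧ deriv z t ∈ S.domV ∧
        S.F t (z t) (deriv z t) (u t) = 0

end ControlDAE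

/-- `G(t, z)` is smooth on `J × Z` and takes its values in `U`. -/
def IsOutputMap {ι κ : Type*} [Fintype ι] [Fintype κ]
    (J : Set ℝ) (Z : Set (ι → ℝ)) (U : Set (κ → ℝ)) (G : ℝ → (ι → ℝ) → κ → ℝ) : Prop :=
  ∀ t ∈ J, ∀ z ∈ Z,
    ContDiffAt ℝ ∞ (fun q : ℝ × (ι → ℝ) => G q.1 q.2) (t, z) ∧ G t z ∈ U

/-- The associated system of the shifted hybrid numerical-experimental system
`0 = F₁(t, z₁, ż₁, G₂(t - τ, z₂(t - τ)))`, `0 = F₂(t, z₂, ż₂, G₁(t, z₁))`: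
the state is `z = (z₁, z₂)` and the delayed state `z(t - τ)` is replaced by a control
`x = (x₁, x₂)`. -/
def shiftedHybrid {ι₁ ι₂ κ₁ κ₂ : Type*} (τ : ℝ)
    (S₁ : ControlDAE ι₁ κ₁) (S₂ : ControlDAE ι₂ κ₂)
    (G₁ : ℝ → (ι₁ → ℝ) → κ₂ → ℝ) (G₂ : ℝ → (ι₂ → ℝ) → κ₁ → ℝ) :
    ControlDAE (ι₁ ⊕ ι₂) (ι₁ ⊕ ι₂) where
  F t z v x := Sum.elim
    (S₁.F t (z ∘ Sum.inl) (v ∘ Sum.inl) (G₂ (t - τ) (x ∘ Sum.inr)))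
    (S₂.F t (z ∘ Sum.inr) (v ∘ Sum.inr) (G₁ t (z ∘ Sum.inl)))
  domZ := {z | z ∘ Sum.inl ∈ S₁.domZ ∧ z ∘ Sum.inr ∈ S₂.domZ}
  domV := {v | v ∘ Sum.inl ∈ S₁.domV ∧ v ∘ Sum.inr ∈ S₂.domV}
  domU := {x | x ∘ Sum.inl ∈ S₁.domZ ∧ x ∘ Sum.inr ∈ S₂.domZ}

end HybridDAE

namespace HybridDAE

open Filter Asymptotics

/-! The proof replaces algebra in jet space by orders of vanishing along curves. A zero of the level
`k` derivative array corresponds to a polynomial curve whose residual is `O((s - t)^(k+1))`. Every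
later statement trades such orders, so each differentiation costs exactly one.

For one subsystem, the rank conditions make the zero set of the array submersive. The constant
corank in `η` then gives a solved constraint `z = B(t, z, u, …, u^(μ))` (`exists_constraint`).
Together with `F = 0`, the differentiated constraint is an overdetermined system for `ż` whose
linearisation is injective. The reason is that a vector `x` with `∂F/∂ż x = 0` and `∂B/∂z x = x` is
tangent to the constraints and hence zero. So `ż = f(t, z, u, …, u^(μ+1))` up to `O((s - t)^(m+1))`
whenever the residual is `O((s - t)^(m+2+μ))` (`StrangenessHypothesis.exists_underlying_ode`).

Once the delayed state is a control, the hybrid system is a cascade: the first subsystem is driven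
by the control alone, the second by `G₁(t, z₁)`. The second equation for `ż₂` needs `μ₂ + 1`
derivatives of `G₁(t, z₁)`. These are Lie derivatives along `ż₁ = f₁` as soon as that equation holds
to order `μ₂ + 1`. This requires residual order `μ₁ + μ₂ + 2`, that is, array level `μ₁ + μ₂ + 1`.
Consistency follows by solving the cascade one subsystem after the other. -/

theorem natCast_le_infty (n : ℕ) : (n : WithTop ℕ∞) ≤ ∞ := by exact_mod_cast le_top

theorem natCast_ne_infty (n : ℕ) : (n : WithTop ℕ∞) ≠ ∞ := by
  exact_mod_cast ENat.natCast_ne_top n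

/-! ### Order of vanishing of a curve at a time, and its calculus. -/

section Flat

variable {V : Type*} [NormedAddCommGroup V]

/-- `g` vanishes to order `m` at `t`. -/
abbrev Flat (m : ℕ) (g : ℝ → V) (t : ℝ) : Prop :=
  g =O[𝓝 t] fun s => (s - t) ^ m

theorem isBigO_pow_sub_of_le {m n : ℕ} (h : n ≤ m) (t : ℝ) :
    (fun s : ℝ => (s - t) ^ m) =O[𝓝 t] fun s => (s - t) ^ n := by
  obtain ⟨k, rfl⟩ := Nat.exists_eq_add_of_le h
  have h1 : (fun s : ℝ => (s - t) ^ k) =O[𝓝 t] fun _ => (1 : ℝ) :=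
    ((by fun_prop : ContinuousAt (fun s : ℝ => (s - t) ^ k) t)).tendsto.isBigO_one ℝ
  simpa [pow_add] using (isBigO_refl (fun s : ℝ => (s - t) ^ n) (𝓝 t)).mul h1

theorem Flat.mono {m n : ℕ} {g : ℝ → V} {t : ℝ} (hg : Flat m g t) (h : n ≤ m) : Flat n g t :=
  IsBigO.trans hg (isBigO_pow_sub_of_le h t)

theorem Flat.eq_zero {m : ℕ} {g : ℝ → V} {t : ℝ} (hg : Flat m g t) (hm : 0 < m) : g t = 0 := by
  have := hg.eq_zero_imp.self_of_nhds
  exact this (by simp [hm.ne'])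

theorem hasDerivAt_pow_sub_div_factorial (t s : ℝ) (i : ℕ) :
    HasDerivAt (fun s : ℝ => (s - t) ^ (i + 1) / ((i + 1)! : ℝ)) ((s - t) ^ i / (i ! : ℝ)) s := by
  have h := (((hasDerivAt_id' s).sub_const t).fun_pow (i + 1)).div_const ((i + 1)! : ℝ)
  have h1 : ((i + 1 : ℕ) : ℝ) ≠ 0 := by positivity
  have h2 : (i ! : ℝ) ≠ 0 := by positivity
  have h3 : ((i + 1 : ℕ) : ℝ) * (s - t) ^ (i + 1 - 1) * 1 / ((i + 1)! : ℝ) =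
      (s - t) ^ i / (i ! : ℝ) := by
    rw [Nat.factorial_succ, Nat.cast_mul, mul_one, Nat.add_sub_cancel, mul_div_mul_left _ _ h1]
  rwa [h3] at h

variable [NormedSpace ℝ V]

theorem contDiffAt_iteratedDeriv {n : ℕ∞} {f : ℝ → V} {t : ℝ} (i : ℕ)
    (hf : ContDiffAt ℝ (n + i : ℕ∞) f t) : ContDiffAt ℝ n (iteratedDeriv i f) t := by
  induction i generalizing n with
  | zero => simpa using hf
  | succ i ih =>
    rw [iteratedDeriv_succ]
    refine ContDiffAt.derivWithin (n := ((n + 1 : ℕ∞) : WithTop ℕ∞)) (ih ?_) (by norm_cast)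
    have : (n + 1 + i : ℕ∞) = n + (i + 1 : ℕ) := by push_cast; ring
    rwa [this]

theorem contDiffAt_iteratedDeriv_infty {f : ℝ → V} {t : ℝ} (i : ℕ)
    (hf : ContDiffAt ℝ ∞ f t) : ContDiffAt ℝ ∞ (iteratedDeriv i f) t :=
  contDiffAt_iteratedDeriv (n := ⊤) i (by simpa using hf)

theorem iteratedDeriv_iteratedDeriv (i j : ℕ) (f : ℝ → V) :
    iteratedDeriv i (iteratedDeriv j f) = iteratedDeriv (i + j) f := by
  simp only [iteratedDeriv_eq_iterate, Function.iterate_add_apply]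

/-- Induction through the derivative: a bound `C |x - t|^m` on `deriv g` integrates to order `m + 1`
by the mean value inequality on the segment from `t` to `s`. -/
theorem flat_of_iteratedDeriv_eq_zero {m : ℕ} {g : ℝ → V} {t : ℝ} (hg : ContDiffAt ℝ m g t)
    (h : ∀ i < m, iteratedDeriv i g t = 0) : Flat m g t := by
  induction m generalizing g with
  | zero => simpa [Flat] using hg.continuousAt.tendsto.isBigO_one ℝ
  | succ m ih =>
    have h1 : Flat m (deriv g) t := by
      refine ih (hg.derivWithin (by norm_cast)) fun i hi => ?_
      rw [← iteratedDeriv_succ']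
      exact h _ (by omega)
    obtain ⟨C, hC⟩ := h1.bound
    have hd : ∀ᶠ s in 𝓝 t, DifferentiableAt ℝ g s := by
      filter_upwards [hg.eventually (by simp)] with s hs
      exact hs.differentiableAt (by simp)
    obtain ⟨ε, hε, hb⟩ := Metric.eventually_nhds_iff_ball.1 (hC.and hd)
    refine IsBigO.of_bound C ?_
    filter_upwards [Metric.ball_mem_nhds t hε] with s hs
    have g0 : g t = 0 := by simpa using h 0 (by omega)
    have hsub : uIcc t s ⊆ Metric.ball t ε :=
      (convex_ball t ε).ordConnected.uIcc_subset (Metric.mem_ball_self hε) hs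
    -- The constant of a big-O bound has no sign; a negative one would bound a norm by a negative
    -- number unless `s = t`.
    have hC0 : 0 ≤ C ∨ s = t := by
      by_contra! hh
      have := (hb s hs).1
      have h2 : 0 < ‖(s - t) ^ m‖ := by
        rw [norm_pos_iff]; exact pow_ne_zero _ (sub_ne_zero.2 hh.2)
      nlinarith [norm_nonneg (deriv g s)]
    rcases hC0 with hC0 | rfl
    · have := Convex.norm_image_sub_le_of_norm_deriv_le (f := g) (s := uIcc t s) (x := t) (y := s)
        (C := C * ‖(s - t) ^ m‖) (fun x hx => (hb x (hsub hx)).2)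
        (fun x hx => (hb x (hsub hx)).1.trans ?_) (convex_uIcc t s) left_mem_uIcc right_mem_uIcc
      · rw [g0, sub_zero] at this
        rwa [pow_succ, norm_mul, ← mul_assoc]
      · gcongr 
        simp only [norm_pow, Real.norm_eq_abs]
        gcongr ?_ ^ m
        exact abs_sub_left_of_mem_uIcc hx
    · simp [g0]

theorem iteratedDeriv_pow_sub_smul (t : ℝ) (c : V) (i l : ℕ) :
    iteratedDeriv l (fun s : ℝ => ((s - t) ^ i / (i ! : ℝ)) • c) t = if l = i then c else 0 := by
  induction l generalizing i with
  | zero => rcases i with _ | i <;> simp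
  | succ l ih =>
    rw [iteratedDeriv_succ']
    rcases i with _ | i
    · have : deriv (fun s : ℝ => ((s - t) ^ 0 / (0 ! : ℝ)) • c) = fun _ => 0 := by
        ext s; simp
      rw [this]
      simp
    · have : deriv (fun s : ℝ => ((s - t) ^ (i + 1) / ((i + 1)! : ℝ)) • c) =
          fun s => ((s - t) ^ i / (i ! : ℝ)) • c := by
        ext s
        exact ((hasDerivAt_pow_sub_div_factorial t s i).smul_const c).deriv
      rw [this, ih]
      simp

/-- The bound is assumed only on a set accumulating at `t`. If `c` is the first derivative that
might not vanish, its Taylor term is `O((s - t)^(i+1))` on that set; dividing by `(s - t)^i` shows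
that the constant `c` tends to `0`. -/
theorem iteratedDeriv_eq_zero_of_isBigO {m : ℕ} {g : ℝ → V} {t : ℝ} {s : Set ℝ}
    (hs : AccPt t (𝓟 s)) (hg : ContDiffAt ℝ m g t)
    (h : g =O[𝓝[s] t] fun s => (s - t) ^ m) {i : ℕ} (hi : i < m) : iteratedDeriv i g t = 0 := by
  induction i using Nat.strong_induction_on with
  | _ i ih =>
    set c := iteratedDeriv i g t with hc
    set q : ℝ → V := fun s => ((s - t) ^ i / (i ! : ℝ)) • c with hq
    have hqs : ContDiff ℝ ∞ q := by fun_prop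
    have h1 : Flat (i + 1) (fun s => g s - q s) t := by
      refine flat_of_iteratedDeriv_eq_zero
        ((hg.of_le (by exact_mod_cast hi)).sub (hqs.contDiffAt.of_le (by exact_mod_cast le_top)))
        fun l hl => ?_
      rw [iteratedDeriv_fun_sub (hg.of_le (by exact_mod_cast (by omega)))
        (hqs.contDiffAt.of_le (by exact_mod_cast le_top)), iteratedDeriv_pow_sub_smul]
      split_ifs with hli
      · rw [hli, hc, sub_self]
      · rw [ih l (by omega) (by omega), sub_zero]
    have h2 : q =O[𝓝[s] t] fun s => (s - t) ^ (i + 1) := by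
      have h3 := (h.trans ((isBigO_pow_sub_of_le hi t).mono inf_le_left)).sub
        (IsBigO.mono h1 (inf_le_left : 𝓝[s] t ≤ 𝓝 t))
      simpa using h3
    have h4 : (fun _ : ℝ => c) =O[𝓝[≠] t ⊓ 𝓟 s] fun s => s - t := by
      obtain ⟨C, hC⟩ := h2.bound
      refine IsBigO.of_bound (C * i !) ?_
      have hle : 𝓝[≠] t ⊓ 𝓟 s ≤ 𝓝[s] t := inf_le_inf_right _ inf_le_left
      have hne : ∀ᶠ x in 𝓝[≠] t ⊓ 𝓟 s, x ≠ t :=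
        (inf_le_left : 𝓝[≠] t ⊓ 𝓟 s ≤ 𝓝[≠] t) self_mem_nhdsWithin
      filter_upwards [hle hC, hne] with x hx hxt
      simp only [hq, norm_smul, norm_div, pow_succ, norm_mul, norm_pow] at hx
      have h5 : 0 < ‖x - t‖ ^ i := pow_pos (norm_pos_iff.2 (sub_ne_zero.2 hxt)) _
      have h6 : (0 : ℝ) < ‖(i ! : ℝ)‖ := by
        rw [norm_pos_iff]; positivity
      have h7 : ‖(i ! : ℝ)‖ = i ! := by simp
      rw [h7] at hx h6
      rw [div_mul_eq_mul_div, div_le_iff₀ h6] at hx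
      refine le_of_mul_le_mul_left ?_ h5
      linarith
    have : (𝓝[≠] t ⊓ 𝓟 s).NeBot := hs
    have h8 : Tendsto (fun _ : ℝ => c) (𝓝[≠] t ⊓ 𝓟 s) (𝓝 0) := by
      refine h4.trans_tendsto ?_
      have : Tendsto (fun s : ℝ => s - t) (𝓝 t) (𝓝 (t - t)) := by
        exact (continuous_id.sub continuous_const).tendsto t
      rw [sub_self] at this
      exact this.mono_left (inf_le_left.trans inf_le_left)
    exact tendsto_nhds_unique tendsto_const_nhds h8

theorem accPt_principal_univ (t : ℝ) : AccPt t (𝓟 (univ : Set ℝ)) := by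
  simp only [AccPt, principal_univ, inf_top_eq]; infer_instance

theorem accPt_principal_Icc {T t : ℝ} (hT : 0 < T) (ht : t ∈ Icc 0 T) :
    AccPt t (𝓟 (Icc 0 T)) :=
  isPreconnected_Icc.preperfect_of_nontrivial ⟨0, by simp [hT.le], T, by simp [hT.le], hT.ne⟩ t ht

theorem Flat.iteratedDeriv_eq_zero {m : ℕ} {g : ℝ → V} {t : ℝ} (h : Flat m g t)
    (hg : ContDiffAt ℝ m g t) {i : ℕ} (hi : i < m) : iteratedDeriv i g t = 0 :=
  iteratedDeriv_eq_zero_of_isBigO (accPt_principal_univ t) hg (by simpa using h) hi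

/-- Needed at the end points of `[0, T]`, where the constraints are known on one side only:
smoothness carries a one-sided order of vanishing to a full neighbourhood. -/
theorem flat_of_isBigO_within {m : ℕ} {g : ℝ → V} {t : ℝ} {s : Set ℝ}
    (hs : AccPt t (𝓟 s)) (hg : ContDiffAt ℝ m g t)
    (h : g =O[𝓝[s] t] fun s => (s - t) ^ m) : Flat m g t :=
  flat_of_iteratedDeriv_eq_zero hg fun _ hi => iteratedDeriv_eq_zero_of_isBigO hs hg h hi

theorem Flat.iteratedDeriv {m : ℕ} (i : ℕ) {g : ℝ → V} {t : ℝ} (h : Flat (m + i) g t)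
    (hg : ContDiffAt ℝ (m + i : ℕ) g t) : Flat m (iteratedDeriv i g) t := by
  refine flat_of_iteratedDeriv_eq_zero
    (contDiffAt_iteratedDeriv (n := m) i (by exact_mod_cast hg)) fun l hl => ?_
  rw [iteratedDeriv_iteratedDeriv]
  exact h.iteratedDeriv_eq_zero hg (by omega)

theorem Flat.deriv {m : ℕ} {g : ℝ → V} {t : ℝ} (h : Flat (m + 1) g t)
    (hg : ContDiffAt ℝ (m + 1 : ℕ) g t) : Flat m (deriv g) t := by
  simpa using h.iteratedDeriv 1 hg

/-- Strict differentiability gives a local Lipschitz bound, through which orders of vanishing pass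
to compositions with nonlinear maps. -/
theorem isBigO_comp_sub_comp {α E : Type*} [NormedAddCommGroup E] [NormedSpace ℝ E]
    {l : Filter α} {f : E → V} {x : E}
    (hf : ContDiffAt ℝ 1 f x) {a b : α → E} (ha : Tendsto a l (𝓝 x)) (hb : Tendsto b l (𝓝 x)) :
    (fun s => f (a s) - f (b s)) =O[l] fun s => a s - b s :=
  (hf.hasStrictFDerivAt (by simp)).isBigO_sub.comp_tendsto (ha.prodMk_nhds hb)

/-- The induction has to carry joint smoothness in parameter and time, since each further time
derivative is a partial derivative of the joint map. -/
theorem contDiffAt_uncurry_iteratedDeriv {P : Type*} [NormedAddCommGroup P] [NormedSpace ℝ P]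
    {H : P → ℝ → V} {p : P} {t : ℝ} (i : ℕ) (hH : ContDiffAt ℝ ∞ (Function.uncurry H) (p, t)) :
    ContDiffAt ℝ ∞ (Function.uncurry fun p => iteratedDeriv i (H p)) (p, t) := by
  induction i with
  | zero => simpa using hH
  | succ i ih =>
    have h1 : ContDiffAt ℝ ∞ (fun q : P × ℝ => fderiv ℝ (iteratedDeriv i (H q.1)) q.2) (p, t) := by
      refine ContDiffAt.fderiv (n := ∞) (f := fun q : P × ℝ => iteratedDeriv i (H q.1)) ?_
        contDiffAt_snd (by simp)
      exact ContDiffAt.comp (((p, t), t) : (P × ℝ) × ℝ)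
        (f := fun q : (P × ℝ) × ℝ => (q.1.1, q.2)) ih (by fun_prop)
    have h2 : (Function.uncurry fun p => iteratedDeriv (i + 1) (H p)) =
        fun q : P × ℝ => fderiv ℝ (iteratedDeriv i (H q.1)) q.2 1 := by
      ext q
      simp [Function.uncurry, iteratedDeriv_succ]
    rw [h2]
    exact h1.clm_apply contDiffAt_const

theorem contDiffAt_iteratedDeriv_param {P : Type*} [NormedAddCommGroup P] [NormedSpace ℝ P]
    {H : P → ℝ → V} {p : P} {τ : P → ℝ} (i : ℕ)
    (hH : ContDiffAt ℝ ∞ (Function.uncurry H) (p, τ p)) (hτ : ContDiffAt ℝ ∞ τ p) :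
    ContDiffAt ℝ ∞ (fun p => iteratedDeriv i (H p) (τ p)) p :=
  ContDiffAt.comp p (f := fun p => (p, τ p)) (contDiffAt_uncurry_iteratedDeriv i hH)
    (contDiffAt_id.prodMk hτ)

end Flat

/-! ### Jets of curves and their Taylor polynomials. -/

section Jet

variable {V : Type*} [NormedAddCommGroup V] [NormedSpace ℝ V]

/-- The derivatives of order `0, …, k` of a curve. -/
noncomputable def jet (k : ℕ) (f : ℝ → V) (t : ℝ) : Fin (k + 1) → V :=
  fun i => iteratedDeriv (i : ℕ) f t

theorem contDiffAt_jet {k : ℕ} {f : ℝ → V} {t : ℝ} (hf : ContDiffAt ℝ ∞ f t) :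
    ContDiffAt ℝ ∞ (jet k f) t :=
  contDiffAt_pi.2 fun i => contDiffAt_iteratedDeriv_infty i hf

theorem contDiff_jetCurve_uncurry (k : ℕ) :
    ContDiff ℝ ∞ fun q : ℝ × (Fin k → V) × ℝ => jetCurve q.1 q.2.1 q.2.2 := by
  unfold jetCurve
  fun_prop

theorem contDiff_jetCurve {k : ℕ} (t : ℝ) (c : Fin k → V) : ContDiff ℝ ∞ (jetCurve t c) := by
  unfold jetCurve
  fun_prop

theorem iteratedDeriv_jetCurve {k : ℕ} (t : ℝ) (c : Fin k → V) (i : Fin k) :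
    iteratedDeriv (i : ℕ) (jetCurve t c) t = c i := by
  unfold jetCurve
  rw [iteratedDeriv_fun_sum fun j _ => by fun_prop]
  simp [iteratedDeriv_pow_sub_smul, Fin.val_inj]

theorem deriv_jetCurve_cons {k : ℕ} (t : ℝ) (z : V) (c : Fin k → V) :
    deriv (jetCurve t (Fin.cons z c : Fin (k + 1) → V)) = jetCurve t c := by
  ext s
  have h : jetCurve t (Fin.cons z c : Fin (k + 1) → V) =
      fun s => z + ∑ j : Fin k, ((s - t) ^ ((j : ℕ) + 1) / ((((j : ℕ) + 1)! : ℕ) : ℝ)) • c j := by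
    ext s
    simp [jetCurve, Fin.sum_univ_succ]
  rw [h]
  refine HasDerivAt.deriv ?_
  refine HasDerivAt.const_add z ?_
  unfold jetCurve
  refine HasDerivAt.fun_sum fun i _ => ?_
  exact (hasDerivAt_pow_sub_div_factorial t s i).smul_const _

theorem flat_sub_jetCurve_jet {k : ℕ} {f : ℝ → V} {t : ℝ} (hf : ContDiffAt ℝ (k + 1 : ℕ) f t) :
    Flat (k + 1) (fun s => f s - jetCurve t (jet k f t) s) t := by
  have hJ : ContDiffAt ℝ (k + 1 : ℕ) (jetCurve t (jet k f t)) t :=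
    (contDiff_jetCurve _ _).contDiffAt.of_le (by exact_mod_cast le_top)
  refine flat_of_iteratedDeriv_eq_zero (hf.sub hJ) fun i hi => ?_
  rw [iteratedDeriv_fun_sub (hf.of_le (by exact_mod_cast hi.le))
    (hJ.of_le (by exact_mod_cast hi.le)), iteratedDeriv_jetCurve t _ (⟨i, hi⟩ : Fin (k + 1))]
  simp [jet]

theorem jetCurve_self {k : ℕ} (t : ℝ) (c : Fin (k + 1) → V) : jetCurve t c t = c 0 := by
  simpa using iteratedDeriv_jetCurve t c 0

/-- The polynomial state curve of a point of the jet space. -/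
noncomputable def stateCurve {ι κ : Type*} {k : ℕ} (p : JetSpace ι κ k) (s : ℝ) : ι → ℝ :=
  jetCurve p.1 (Fin.cons p.2.1 p.2.2.1 : Fin (k + 2) → ι → ℝ) s

theorem contDiff_stateCurve_uncurry {ι κ : Type*} [Fintype ι] [Fintype κ] (k : ℕ) :
    ContDiff ℝ ∞ (Function.uncurry (stateCurve : JetSpace ι κ k → ℝ → ι → ℝ)) := by
  refine (contDiff_jetCurve_uncurry (V := ι → ℝ) (k + 2)).comp (f := fun q : JetSpace ι κ k × ℝ =>
    (q.1.1, (Fin.cons q.1.2.1 q.1.2.2.1 : Fin (k + 2) → ι → ℝ), q.2)) ?_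
  refine ContDiff.prodMk (by fun_prop) (ContDiff.prodMk (contDiff_pi.2 fun i => ?_) (by fun_prop))
  refine Fin.cases ?_ (fun j => ?_) i
  · simp only [Fin.cons_zero]; fun_prop
  · simp only [Fin.cons_succ]; fun_prop

end Jet

/-! ### Linear algebra of the strangeness rank conditions. -/

section LinearAlgebra

open Module

variable {w ι : Type*} [Fintype w] [Fintype ι]

theorem range_mulVecLin_eq_ker {α β γ : Type*} [Fintype α] [Fintype β] [Fintype γ]
    (A : Matrix α β ℝ) (B : Matrix β γ ℝ)
    (h : A * B = 0) (hr : A.rank + B.rank = Fintype.card β) :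
    LinearMap.range B.mulVecLin = LinearMap.ker A.mulVecLin := by
  refine Submodule.eq_of_le_of_finrank_eq ?_ ?_
  · rintro _ ⟨x, rfl⟩
    simp [h]
  · have := A.mulVecLin.finrank_range_add_finrank_ker
    simp only [Matrix.rank, Module.finrank_fintype_fun_eq_card] at *
    omega

theorem mulVecLin_surjective_of_rank {α β : Type*} [Fintype α] [Fintype β]
    (A : Matrix α β ℝ) (h : A.rank = Fintype.card α) : Function.Surjective A.mulVecLin := by
  rw [← LinearMap.range_eq_top]
  refine Submodule.eq_top_of_finrank_eq ?_
  simpa [Matrix.rank] using h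

theorem mulVecLin_injective_of_rank {α β : Type*} [Fintype α] [Fintype β]
    (A : Matrix α β ℝ) (h : A.rank = Fintype.card β) : Function.Injective A.mulVecLin := by
  rw [← LinearMap.ker_eq_bot, ← Submodule.finrank_eq_zero]
  have := A.mulVecLin.finrank_range_add_finrank_ker
  simp only [Matrix.rank, Module.finrank_fintype_fun_eq_card] at *
  omega

/-- By dimension count the range of `A` is the kernel of `Zᵀ`. Since `Zᵀ B` is onto, some `x`
corrects `y` into that kernel. -/
theorem jacobian_surjective {a : ℕ} (Z : Matrix w (Fin a) ℝ) (A : Matrix w w ℝ)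
    (B : Matrix w ι ℝ) (hZ : Z.rank = a) (hA : A.rank + a = Fintype.card w)
    (hZA : Z.transpose * A = 0) (hZB : (Z.transpose * B).rank = a) (y : w → ℝ) :
    ∃ x v, B.mulVec x + A.mulVec v = y := by
  obtain ⟨x, hx⟩ := mulVecLin_surjective_of_rank (Z.transpose * B) (by simpa using hZB)
    (Z.transpose.mulVec y)
  have hk : y - B.mulVec x ∈ LinearMap.ker Z.transpose.mulVecLin := by
    simp only [Matrix.mulVecLin_apply, ← Matrix.mulVec_mulVec] at hx
    rw [LinearMap.mem_ker, Matrix.mulVecLin_apply, Matrix.mulVec_sub, hx, sub_self]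
  rw [← range_mulVecLin_eq_ker _ A hZA (by rw [Matrix.rank_transpose]; omega)] at hk
  obtain ⟨v, hv⟩ := hk
  refine ⟨x, v, ?_⟩
  rw [← Matrix.mulVecLin_apply A, hv]
  abel

/-- Applying `Zᵀ` removes `v` and puts `x` in the kernel of `Zᵀ B`, which is the range of `K` by
dimension; on that range `C` is injective. -/
theorem jacobian_eq_zero {a d : ℕ} (had : a + d = Fintype.card ι)
    (Z : Matrix w (Fin a) ℝ) (A : Matrix w w ℝ)
    (B : Matrix w ι ℝ) (K : Matrix ι (Fin d) ℝ) (C : Matrix ι ι ℝ)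
    (hZA : Z.transpose * A = 0) (hZB : (Z.transpose * B).rank = a) (hK : K.rank = d)
    (hBK : Z.transpose * B * K = 0) (hC : (C * K).rank = d) (x : ι → ℝ) (v : w → ℝ)
    (h : B.mulVec x + A.mulVec v = 0) (hx : C.mulVec x = 0) : x = 0 := by
  have hk : x ∈ LinearMap.ker (Z.transpose * B).mulVecLin := by
    have h1 : Z.transpose.mulVec (B.mulVec x + A.mulVec v) = 0 := by rw [h]; simp
    rwa [Matrix.mulVec_add, Matrix.mulVec_mulVec, Matrix.mulVec_mulVec, hZA, Matrix.zero_mulVec,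
      add_zero] at h1
  rw [← range_mulVecLin_eq_ker _ K hBK (by omega)] at hk
  obtain ⟨y, rfl⟩ := hk
  have h2 : (C * K).mulVecLin y = 0 := by simpa [Matrix.mulVec_mulVec] using hx
  have h3 := mulVecLin_injective_of_rank (C * K) (by simpa using hC)
    (h2.trans (map_zero (C * K).mulVecLin).symm)
  rw [h3, map_zero]

end LinearAlgebra

/-! ### Derivative arrays along curves, and regularity of their zeros. -/

namespace ControlDAE

open Module

variable {ι κ : Type*} [Fintype ι] [Fintype κ]

set_option linter.unusedSectionVars false

/-- `F` is `n` times continuously differentiable at the point `(t, z, v, u)`. -/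
def SmoothAt (S : ControlDAE ι κ) (n : ℕ∞) (t : ℝ) (z v : ι → ℝ) (u : κ → ℝ) : Prop :=
  ContDiffAt ℝ n
    (fun q : ℝ × (ι → ℝ) × (ι → ℝ) × (κ → ℝ) => S.F q.1 q.2.1 q.2.2.1 q.2.2.2) (t, z, v, u)

/-- The residual of a pair of curves. -/
noncomputable def residual (S : ControlDAE ι κ) (z : ℝ → ι → ℝ) (u : ℝ → κ → ℝ) (s : ℝ) : ι → ℝ :=
  S.F s (z s) (deriv z s) (u s)

variable {S : ControlDAE ι κ} {z z' : ℝ → ι → ℝ} {u u' : ℝ → κ → ℝ} {t : ℝ}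

theorem contDiffAt_residual {n : ℕ∞} (hS : S.SmoothAt n t (z t) (deriv z t) (u t))
    (hz : ContDiffAt ℝ (n + 1 : ℕ∞) z t) (hu : ContDiffAt ℝ n u t) :
    ContDiffAt ℝ n (S.residual z u) t :=
  ContDiffAt.comp t (f := fun s => (s, z s, deriv z s, u s)) hS
    (contDiffAt_id.prodMk ((hz.of_le (by exact_mod_cast le_self_add)).prodMk
      ((hz.derivWithin (by norm_cast)).prodMk hu)))

/-- The states must agree to one order more than the controls because the residual contains `ż`. -/
theorem flat_residual_sub {k : ℕ} (hS : S.SmoothAt 1 t (z t) (deriv z t) (u t))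
    (hz : ContDiffAt ℝ (k + 2 : ℕ) z t) (hz' : ContDiffAt ℝ (k + 2 : ℕ) z' t)
    (hu : ContinuousAt u t) (hu' : ContinuousAt u' t)
    (h : Flat (k + 2) (fun s => z s - z' s) t) (h' : Flat (k + 1) (fun s => u s - u' s) t) :
    Flat (k + 1) (fun s => S.residual z u s - S.residual z' u' s) t := by
  have h1 : Flat (k + 1) (fun s => deriv z s - deriv z' s) t := by
    have h2 := Flat.deriv h (hz.sub hz')
    refine h2.congr' ?_ EventuallyEq.rfl
    filter_upwards [hz.eventually (natCast_ne_infty _),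
      hz'.eventually (natCast_ne_infty _)] with s hs hs'
    exact deriv_fun_sub (hs.differentiableAt (by simp)) (hs'.differentiableAt (by simp))
  have hd : ∀ f : ℝ → ι → ℝ, ContDiffAt ℝ (k + 2 : ℕ) f t → ContinuousAt (deriv f) t := fun f hf =>
    (hf.derivWithin (m := (k + 1 : ℕ)) (by norm_cast)).continuousAt
  have c1 : ContinuousAt (fun s => (s, z s, deriv z s, u s)) t :=
    continuousAt_id.prodMk (hz.continuousAt.prodMk ((hd z hz).prodMk hu))
  have c2 : ContinuousAt (fun s => (s, z' s, deriv z' s, u' s)) t :=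
    continuousAt_id.prodMk (hz'.continuousAt.prodMk ((hd z' hz').prodMk hu'))
  have c2' : Tendsto (fun s => (s, z' s, deriv z' s, u' s)) (𝓝 t)
      (𝓝 (t, z t, deriv z t, u t)) := by
    have e1 := h.eq_zero (by omega)
    have e2 := h1.eq_zero (by omega)
    have e3 := h'.eq_zero (by omega)
    rw [sub_eq_zero] at e1 e2 e3
    rw [e1, e2, e3]
    exact c2
  refine IsBigO.trans (isBigO_comp_sub_comp hS c1.tendsto c2') ?_
  have h0 : (fun s : ℝ => s - s) =O[𝓝 t] fun s => (s - t) ^ (k + 1) := by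
    simpa using isBigO_zero _ _
  exact h0.prod_left ((h.mono (by omega)).prod_left (h1.prod_left h'))

theorem cons_jet_deriv {V : Type*} [NormedAddCommGroup V] [NormedSpace ℝ V] (k : ℕ) (z : ℝ → V)
    (t : ℝ) : (Fin.cons (z t) (jet k (deriv z) t) : Fin (k + 2) → V) = jet (k + 1) z t := by
  ext i
  refine Fin.cases ?_ (fun j => ?_) i
  · simp [jet]
  · simp [jet, iteratedDeriv_succ']

/-- The array is defined through Taylor polynomials. Replacing a curve by its Taylor polynomial
changes the residual only at order `k + 1`, invisible to derivatives of order at most `k`; hence any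
curve with the given jet computes the array. -/
theorem derivArray_jet {k : ℕ} (hS : S.SmoothAt (k + 1 : ℕ) t (z t) (deriv z t) (u t))
    (hz : ContDiffAt ℝ (k + 2 : ℕ) z t) (hu : ContDiffAt ℝ (k + 1 : ℕ) u t) :
    S.derivArray k t (z t) (jet k (deriv z) t) (jet k u t) = jet k (S.residual z u) t := by
  ext1 i
  unfold derivArray
  rw [cons_jet_deriv]
  have cz : ContDiffAt ℝ (k + 2 : ℕ) (jetCurve t (jet (k + 1) z t)) t :=
    (contDiff_jetCurve _ _).contDiffAt.of_le (natCast_le_infty _)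
  have cu : ContDiffAt ℝ (k + 1 : ℕ) (jetCurve t (jet k u t)) t :=
    (contDiff_jetCurve _ _).contDiffAt.of_le (natCast_le_infty _)
  have h := flat_residual_sub (k := k) (ContDiffAt.of_le hS (by norm_cast; omega)) hz cz
    hu.continuousAt cu.continuousAt (flat_sub_jetCurve_jet hz) (flat_sub_jetCurve_jet hu)
  have hS' : S.SmoothAt (k + 1 : ℕ) t (jetCurve t (jet (k + 1) z t) t)
      (deriv (jetCurve t (jet (k + 1) z t)) t) (jetCurve t (jet k u t) t) := by
    rw [← cons_jet_deriv, deriv_jetCurve_cons]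
    simpa [jetCurve_self, jet] using hS
  have c1 := contDiffAt_residual hS (by exact_mod_cast hz) hu
  have c2 := contDiffAt_residual hS' (by exact_mod_cast cz) cu
  have h3 := h.iteratedDeriv_eq_zero (c1.sub c2) i.2
  rw [iteratedDeriv_fun_sub (c1.of_le (by exact_mod_cast i.2.le))
    (c2.of_le (by exact_mod_cast i.2.le)), sub_eq_zero] at h3
  exact h3.symm

/-- The derivative array as a function on the jet space. -/
noncomputable def arrayFun (S : ControlDAE ι κ) (k : ℕ) (p : JetSpace ι κ k) :
    Fin (k + 1) → ι → ℝ :=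
  S.derivArray k p.1 p.2.1 p.2.2.1 p.2.2.2

theorem contDiffAt_arrayFun {k : ℕ} {p : JetSpace ι κ k}
    (hS : S.SmoothAt ⊤ p.1 p.2.1 (p.2.2.1 0) (p.2.2.2 0)) :
    ContDiffAt ℝ ∞ (S.arrayFun k) p := by
  refine contDiffAt_pi.2 fun i => ?_
  refine contDiffAt_iteratedDeriv_param (τ := fun p : JetSpace ι κ k => p.1)
    (H := fun (p : JetSpace ι κ k) s => S.F s
      (jetCurve p.1 (Fin.cons p.2.1 p.2.2.1 : Fin (k + 2) → ι → ℝ) s)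
      (deriv (jetCurve p.1 (Fin.cons p.2.1 p.2.2.1 : Fin (k + 2) → ι → ℝ)) s)
      (jetCurve p.1 p.2.2.2 s)) i ?_ contDiffAt_fst
  simp only [deriv_jetCurve_cons]
  have h1 := contDiff_stateCurve_uncurry (ι := ι) (κ := κ) k
  have h2 : ContDiff ℝ ∞ fun q : JetSpace ι κ k × ℝ => jetCurve q.1.1 q.1.2.2.1 q.2 :=
    (contDiff_jetCurve_uncurry (V := ι → ℝ) (k + 1)).comp (f := fun q : JetSpace ι κ k × ℝ =>
      (q.1.1, q.1.2.2.1, q.2)) (by fun_prop)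
  have h3 : ContDiff ℝ ∞ fun q : JetSpace ι κ k × ℝ => jetCurve q.1.1 q.1.2.2.2 q.2 :=
    (contDiff_jetCurve_uncurry (V := κ → ℝ) (k + 1)).comp (f := fun q : JetSpace ι κ k × ℝ =>
      (q.1.1, q.1.2.2.2, q.2)) (by fun_prop)
  refine ContDiffAt.comp (p, p.1)
    (g := fun q : ℝ × (ι → ℝ) × (ι → ℝ) × (κ → ℝ) => S.F q.1 q.2.1 q.2.2.1 q.2.2.2)
    (f := fun q : JetSpace ι κ k × ℝ =>
      (q.2, jetCurve q.1.1 (Fin.cons q.1.2.1 q.1.2.2.1 : Fin (k + 2) → ι → ℝ) q.2,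
        jetCurve q.1.1 q.1.2.2.1 q.2, jetCurve q.1.1 q.1.2.2.2 q.2)) ?_
    (contDiffAt_snd.prodMk (h1.contDiffAt.prodMk (h2.contDiffAt.prodMk h3.contDiffAt)))
  simpa [jetCurve_self, SmoothAt] using hS

/-- The partial derivative of the derivative array with respect to `z`. -/
noncomputable def arrayDerivZ (S : ControlDAE ι κ) (k : ℕ) (p : JetSpace ι κ k) :
    (ι → ℝ) →L[ℝ] (Fin (k + 1) → ι → ℝ) :=
  fderiv ℝ (fun z => S.derivArray k p.1 z p.2.2.1 p.2.2.2) p.2.1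

/-- The partial derivative of the derivative array with respect to `η`. -/
noncomputable def arrayDerivEta (S : ControlDAE ι κ) (k : ℕ) (p : JetSpace ι κ k) :
    (Fin (k + 1) → ι → ℝ) →L[ℝ] (Fin (k + 1) → ι → ℝ) :=
  fderiv ℝ (fun η => S.derivArray k p.1 p.2.1 η p.2.2.2) p.2.2.1

open Classical in
theorem jacEta_mulVec {k : ℕ} (p : JetSpace ι κ k) (η : Fin (k + 1) → ι → ℝ) :
    (S.jacEta k p).mulVec (fun j => η j.1 j.2) = fun i => S.arrayDerivEta k p η i.1 i.2 := by
  have h : η = ∑ j : Fin (k + 1) × ι,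
      η j.1 j.2 • (Pi.single j.1 (Pi.single j.2 1) : Fin (k + 1) → ι → ℝ) := by
    ext a b
    simp [Fintype.sum_prod_type, Pi.single_apply, ite_apply]
  ext i
  conv_rhs => rw [h, map_sum]
  simp [Matrix.mulVec, dotProduct, jacEta, arrayDerivEta, mul_comm]

open Classical in
theorem jacZ_mulVec {k : ℕ} (p : JetSpace ι κ k) (x : ι → ℝ) :
    (S.jacZ k p).mulVec x = fun i => S.arrayDerivZ k p x i.1 i.2 := by
  ext i
  conv_rhs => rw [pi_eq_sum_univ' x, map_sum]
  simp [Matrix.mulVec, dotProduct, jacZ, arrayDerivZ, mul_comm]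

open Classical in
theorem jacV_mulVec {k : ℕ} (p : JetSpace ι κ k) (x : ι → ℝ) :
    (S.jacV k p).mulVec x =
      fderiv ℝ (fun v => S.F p.1 p.2.1 v (p.2.2.2 0)) (p.2.2.1 0) x := by
  ext i
  conv_rhs => rw [pi_eq_sum_univ' x, map_sum]
  simp [Matrix.mulVec, dotProduct, jacV, mul_comm]

/-- Turns the rank condition on the matrix into constancy of a kernel dimension, the coordinate-free
form used by the constant rank argument. -/
theorem finrank_ker_arrayDerivEta {k : ℕ} (p : JetSpace ι κ k) :
    (S.jacEta k p).rank + finrank ℝ (LinearMap.ker (S.arrayDerivEta k p).toLinearMap) =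
      (k + 1) * Fintype.card ι := by
  let e : (Fin (k + 1) × ι → ℝ) ≃ₗ[ℝ] (Fin (k + 1) → ι → ℝ) :=
    LinearEquiv.curry ℝ ℝ (Fin (k + 1)) ι
  have h1 : (S.jacEta k p).mulVecLin =
      e.symm.toLinearMap ∘ₗ (S.arrayDerivEta k p).toLinearMap ∘ₗ e.toLinearMap := by
    ext1 x
    exact jacEta_mulVec p (e x)
  have h2 := (S.arrayDerivEta k p).toLinearMap.finrank_range_add_finrank_ker
  have h3 : (S.jacEta k p).rank =
      finrank ℝ (LinearMap.range (S.arrayDerivEta k p).toLinearMap) := by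
    rw [Matrix.rank, h1, LinearMap.range_comp, LinearEquiv.finrank_map_eq, LinearMap.range_comp,
      LinearEquiv.range, Submodule.map_top]
  rw [h3, h2]
  simp [Module.finrank_pi_fintype]

/-- The consequences of the strangeness hypothesis at a zero `p₀` of the derivative array that are
used below. -/
structure IsRegularAt (T : ℝ) (S : ControlDAE ι κ) (k : ℕ) (p₀ : JetSpace ι κ k) : Prop where
  surjective : ∀ w, ∃ x y, S.arrayDerivZ k p₀ x + S.arrayDerivEta k p₀ y = w
  eq_zero : ∀ x y, S.arrayDerivZ k p₀ x + S.arrayDerivEta k p₀ y = 0 →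
    fderiv ℝ (fun v => S.F p₀.1 p₀.2.1 v (p₀.2.2.2 0)) (p₀.2.2.1 0) x = 0 → x = 0
  finrank_ker : ∀ᶠ p in 𝓝 p₀, p ∈ S.solSet T k →
    finrank ℝ (LinearMap.ker (S.arrayDerivEta k p).toLinearMap) =
      finrank ℝ (LinearMap.ker (S.arrayDerivEta k p₀).toLinearMap)

theorem StrangenessHypothesis.isRegularAt {T : ℝ} {k : ℕ} (h : S.StrangenessHypothesis T k)
    {p₀ : JetSpace ι κ k} (hp₀ : p₀ ∈ S.solSet T k) : S.IsRegularAt T k p₀ := by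
  obtain ⟨a, d, had, ZA, TA, ZD, -, h⟩ := h
  obtain ⟨U, hU, h⟩ := h p₀ hp₀
  obtain ⟨⟨r1, r2, -⟩, ⟨e1, e2⟩, ⟨z1, z2⟩, ⟨v1, -⟩⟩ := h p₀ ⟨hp₀, mem_of_mem_nhds hU⟩
  refine ⟨fun w => ?_, fun x y h1 h2 => ?_, ?_⟩
  · obtain ⟨x, v, hxv⟩ := jacobian_surjective (ZA p₀) _ _ r1 (by simpa using e1) e2 z1
      (fun i => w i.1 i.2)
    refine ⟨x, fun i j => v (i, j), ?_⟩
    have hv := jacEta_mulVec (S := S) p₀ fun i j => v (i, j)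
    rw [jacZ_mulVec] at hxv
    ext i j
    have h1 := congrFun hxv (i, j)
    have h2 := congrFun hv (i, j)
    simp only [Pi.add_apply] at h1 ⊢
    rw [← h2]
    exact h1
  · refine jacobian_eq_zero had (ZA p₀) (S.jacEta k p₀) (S.jacZ k p₀) (TA p₀) (S.jacV k p₀)
      e2 z1 r2 z2 v1 x (fun j => y j.1 j.2) ?_ ?_
    · rw [jacZ_mulVec, jacEta_mulVec]
      ext i
      exact congrFun (congrFun h1 i.1) i.2
    · rw [jacV_mulVec, h2]
  · filter_upwards [hU] with p hpU hp
    have e3 := (h p ⟨hp, hpU⟩).2.1.1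
    have f1 := finrank_ker_arrayDerivEta (S := S) p
    have f2 := finrank_ker_arrayDerivEta (S := S) p₀
    omega

end ControlDAE

/-! ### Constant rank theorem on the zero set, and solving an overdetermined equation. -/

section Constraint

open Module

variable {Z H Y W : Type*} [NormedAddCommGroup Z] [NormedSpace ℝ Z] [NormedAddCommGroup H]
  [NormedSpace ℝ H] [NormedAddCommGroup Y] [NormedSpace ℝ Y] [NormedAddCommGroup W]
  [NormedSpace ℝ W]

/-- The inclusion of the third factor. -/
noncomputable def inclEta (Z H Y : Type*) [NormedAddCommGroup Z] [NormedSpace ℝ Z]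
    [NormedAddCommGroup H] [NormedSpace ℝ H] [NormedAddCommGroup Y] [NormedSpace ℝ Y] :
    H →L[ℝ] ℝ × Z × H × Y :=
  (0 : H →L[ℝ] ℝ).prod ((0 : H →L[ℝ] Z).prod ((ContinuousLinearMap.id ℝ H).prod (0 : H →L[ℝ] Y)))

@[simp]
theorem inclEta_apply (h : H) : inclEta Z H Y h = (0, 0, h, 0) := rfl

theorem exists_projection [FiniteDimensional ℝ Z] (p : Submodule ℝ Z) :
    ∃ f : Z →L[ℝ] p, ∀ x : p, f x = x := by
  obtain ⟨g, hg⟩ := p.subtype.exists_leftInverse_of_injective p.ker_subtype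
  exact ⟨LinearMap.toContinuousLinearMap g, fun x => LinearMap.congr_fun hg x⟩

/-- A constant rank theorem: if the partial derivative of `D` with respect to the third variable
has constant corank on the zero set of `D` over `I`, then this zero set satisfies an equation
`z = B (t, z, y)`, where the derivative of `B` with respect to `z` is (up to the choice of
complements) the projection to the tangent directions. -/
theorem exists_constraint [FiniteDimensional ℝ Z] [FiniteDimensional ℝ H] [FiniteDimensional ℝ Y]
    [FiniteDimensional ℝ W] (I : Set ℝ) {D : ℝ × Z × H × Y → W} {p₀ : ℝ × Z × H × Y}
    (hD : ContDiffAt ℝ ∞ D p₀) (hD0 : D p₀ = 0)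
    (hsurj : ∀ w, ∃ x y, fderiv ℝ D p₀ (0, x, y, 0) = w)
    (hker : ∀ᶠ p in 𝓝 p₀, p.1 ∈ I → D p = 0 →
      finrank ℝ (LinearMap.ker (fderiv ℝ D p ∘L inclEta Z H Y).toLinearMap) =
        finrank ℝ (LinearMap.ker (fderiv ℝ D p₀ ∘L inclEta Z H Y).toLinearMap)) :
    ∃ (B : ℝ × Z × Y → Z) (G : ℝ × W × Z × H × Y → Z),
      ContDiffAt ℝ ∞ B (p₀.1, p₀.2.1, p₀.2.2.2) ∧
      ContDiffAt ℝ ∞ G (p₀.1, 0, p₀.2.1, p₀.2.2.1, p₀.2.2.2) ∧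
      (∀ x, ∃ y, fderiv ℝ D p₀
        (0, fderiv ℝ B (p₀.1, p₀.2.1, p₀.2.2.2) (0, x, 0), y, 0) = 0) ∧
      (∀ᶠ p in 𝓝 p₀, G (p.1, D p, p.2.1, p.2.2.1, p.2.2.2) = p.2.1) ∧
      (∀ᶠ p in 𝓝 p₀, p.1 ∈ I →
        G (p.1, 0, p.2.1, p.2.2.1, p.2.2.2) = B (p.1, p.2.1, p.2.2.2)) := by
  set H2 : Submodule ℝ H := LinearMap.ker (fderiv ℝ D p₀ ∘L inclEta Z H Y).toLinearMap with hH2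
  let iz : Z →L[ℝ] ℝ × Z × H × Y :=
    (0 : Z →L[ℝ] ℝ).prod ((ContinuousLinearMap.id ℝ Z).prod (0 : Z →L[ℝ] H × Y))
  -- The `z`-directions that some `η`-direction completes to a tangent vector of the zero set with
  -- `t` and `y` fixed.
  let Z2 : Submodule ℝ Z := Submodule.comap (fderiv ℝ D p₀ ∘L iz).toLinearMap
    (LinearMap.range (fderiv ℝ D p₀ ∘L inclEta Z H Y).toLinearMap)
  have hZ2 : ∀ x, x ∈ Z2 ↔ ∃ y, fderiv ℝ D p₀ (0, x, y, 0) = 0 := by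
    intro x
    have hsplit : ∀ y, fderiv ℝ D p₀ (0, x, y, 0) =
        fderiv ℝ D p₀ (iz x) + fderiv ℝ D p₀ (inclEta Z H Y y) := by
      intro y
      rw [← map_add]
      simp [iz]
    constructor
    · rintro ⟨y, hy⟩
      refine ⟨-y, ?_⟩
      rw [hsplit, map_neg, map_neg, add_neg_eq_zero]
      exact hy.symm
    · rintro ⟨y, hy⟩
      refine ⟨-y, ?_⟩
      rw [hsplit] at hy
      change fderiv ℝ D p₀ (inclEta Z H Y (-y)) = fderiv ℝ D p₀ (iz x)
      rw [map_neg, map_neg]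
      exact (eq_neg_of_add_eq_zero_left hy).symm
  obtain ⟨π, hπ⟩ := exists_projection Z2
  obtain ⟨ρ, hρ⟩ := exists_projection H2
  -- `D` together with projections onto its kernel directions gives a local chart that straightens
  -- the zero set; `Φ` below is its inverse.
  let Ψ : ℝ × Z × H × Y → ℝ × W × Z2 × H2 × Y :=
    fun p => (p.1, D p, π p.2.1, ρ p.2.2.1, p.2.2.2)
  let prj : ℝ × Z × H × Y →L[ℝ] Z2 × H2 × Y := π.prodMap (ρ.prodMap (ContinuousLinearMap.id ℝ Y))
    ∘L ContinuousLinearMap.snd ℝ ℝ (Z × H × Y)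
  let dΨ : ℝ × Z × H × Y → (ℝ × Z × H × Y →L[ℝ] ℝ × W × Z2 × H2 × Y) := fun p =>
    (ContinuousLinearMap.fst ℝ ℝ (Z × H × Y)).prod ((fderiv ℝ D p).prod prj)
  have dΨ_apply : ∀ p v, dΨ p v = (v.1, fderiv ℝ D p v, π v.2.1, ρ v.2.2.1, v.2.2.2) :=
    fun p v => rfl
  have hΨ : ∀ p, DifferentiableAt ℝ D p → HasFDerivAt Ψ (dΨ p) p := fun p hp =>
    hasFDerivAt_fst.prodMk (hp.hasFDerivAt.prodMk prj.hasFDerivAt)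
  have hΨs : ContDiffAt ℝ ∞ Ψ p₀ := contDiffAt_fst.prodMk (hD.prodMk prj.contDiff.contDiffAt)
  have hinj : LinearMap.ker (dΨ p₀).toLinearMap = ⊥ := by
    rw [LinearMap.ker_eq_bot']
    rintro ⟨t, x, y, v⟩ hv
    have hv' : dΨ p₀ (t, x, y, v) = 0 := hv
    simp only [dΨ_apply, Prod.mk_eq_zero] at hv'
    obtain ⟨rfl, h1, h2, h3, rfl⟩ := hv'
    have hx : x ∈ Z2 := (hZ2 x).2 ⟨y, h1⟩
    have hx0 : x = 0 := by
      have := hπ ⟨x, hx⟩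
      rw [h2] at this
      exact (congrArg Subtype.val this).symm
    subst hx0
    have hy0 : y = 0 := by
      have := hρ ⟨y, h1⟩
      rw [h3] at this
      exact (congrArg Subtype.val this).symm
    rw [hy0]
    rfl
  have hsur : LinearMap.range (dΨ p₀).toLinearMap = ⊤ := by
    rw [LinearMap.range_eq_top]
    rintro ⟨t, w, x, y, v⟩
    obtain ⟨x1, y1, h1⟩ := hsurj (w - fderiv ℝ D p₀ (t, 0, 0, v))
    obtain ⟨y2, h2⟩ := (hZ2 _).1 (x - π x1).2
    refine ⟨(t, x1 + (x - π x1 : Z2), y1 + y2 + (y - ρ (y1 + y2) : H2), v), ?_⟩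
    change dΨ p₀ _ = _
    have h3 : fderiv ℝ D p₀ (0, 0, ((y - ρ (y1 + y2) : H2) : H), 0) = 0 :=
      (y - ρ (y1 + y2)).2
    have hs : ((t, x1 + (x - π x1 : Z2), y1 + y2 + (y - ρ (y1 + y2) : H2), v) : ℝ × Z × H × Y) =
        (t, 0, 0, v) + (0, x1, y1, 0) + (0, ((x - π x1 : Z2) : Z), y2, 0) +
          (0, 0, ((y - ρ (y1 + y2) : H2) : H), 0) := by
      simp
    have key : fderiv ℝ D p₀
        (t, x1 + (x - π x1 : Z2), y1 + y2 + (y - ρ (y1 + y2) : H2), v) = w := by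
      rw [hs, map_add, map_add, map_add, h1, h2, h3]
      abel
    rw [dΨ_apply, key]
    simp only [map_add, hπ, hρ, add_sub_cancel]
  let e := ContinuousLinearEquiv.ofBijective (dΨ p₀) hinj hsur
  have he : (e : ℝ × Z × H × Y →L[ℝ] ℝ × W × Z2 × H2 × Y) = dΨ p₀ := by
    exact ContinuousLinearMap.ext fun v => rfl
  have hΨ0 : HasFDerivAt Ψ (e : ℝ × Z × H × Y →L[ℝ] ℝ × W × Z2 × H2 × Y) p₀ := by
    rw [he]
    exact hΨ p₀ (hD.differentiableAt (by simp))
  have hstr := hΨs.hasStrictFDerivAt' hΨ0 (by simp)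
  have hΦs := hΨs.to_localInverse hΨ0 (by simp)
  have hleft := hstr.eventually_left_inverse
  have hright := hstr.eventually_right_inverse
  have hΦ0 := hstr.to_localInverse
  have hΦp₀ := hstr.localInverse_apply_image
  change ContDiffAt ℝ ∞ (hstr.localInverse Ψ e p₀) (Ψ p₀) at hΦs
  set Φ := hstr.localInverse Ψ e p₀ with hΦ
  have hq₀ : Ψ p₀ = (p₀.1, 0, π p₀.2.1, ρ p₀.2.2.1, p₀.2.2.2) := by simp [Ψ, hD0]
  let lin : ℝ × W × Z × H × Y →L[ℝ] ℝ × W × Z2 × H2 × Y :=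
    (ContinuousLinearMap.id ℝ ℝ).prodMap ((ContinuousLinearMap.id ℝ W).prodMap
      (π.prodMap (ρ.prodMap (ContinuousLinearMap.id ℝ Y))))
  let G : ℝ × W × Z × H × Y → Z := fun q => (Φ (lin q)).2.1
  -- Freezing `η` at its base value loses nothing: `G` with defect zero is shown below to be locally
  -- independent of `η` for times in `I`.
  let B : ℝ × Z × Y → Z := fun q => G (q.1, 0, q.2.1, p₀.2.2.1, q.2.2)
  have hGs : ContDiffAt ℝ ∞ G (p₀.1, 0, p₀.2.1, p₀.2.2.1, p₀.2.2.2) := by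
    have h1 : ContDiffAt ℝ ∞ (fun q => Φ (lin q)) (p₀.1, 0, p₀.2.1, p₀.2.2.1, p₀.2.2.2) := by
      refine ContDiffAt.comp (g := Φ) (f := lin) _ ?_ lin.contDiff.contDiffAt
      rw [hq₀] at hΦs
      exact hΦs
    exact h1.snd.fst
  have hBs : ContDiffAt ℝ ∞ B (p₀.1, p₀.2.1, p₀.2.2.2) :=
    ContDiffAt.comp (g := G)
      (f := fun q : ℝ × Z × Y => ((q.1, 0, q.2.1, p₀.2.2.1, q.2.2) : ℝ × W × Z × H × Y)) _ hGs
      (by fun_prop)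
  refine ⟨B, G, hBs, hGs, fun x => ?_, ?_, ?_⟩
  · let ι3 : ℝ × Z × Y →L[ℝ] ℝ × W × Z2 × H2 × Y :=
      lin ∘L ((ContinuousLinearMap.fst ℝ ℝ (Z × Y)).prod ((0 : _ →L[ℝ] W).prod
        ((ContinuousLinearMap.fst ℝ Z Y ∘L ContinuousLinearMap.snd ℝ ℝ (Z × Y)).prod
          ((0 : _ →L[ℝ] H).prod
            (ContinuousLinearMap.snd ℝ Z Y ∘L ContinuousLinearMap.snd ℝ ℝ (Z × Y))))))
    have hι : HasFDerivAt (fun q : ℝ × Z × Y =>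
        lin ((q.1, 0, q.2.1, p₀.2.2.1, q.2.2) : ℝ × W × Z × H × Y)) ι3
        (p₀.1, p₀.2.1, p₀.2.2.2) := by
      refine lin.hasFDerivAt.comp _ ?_
      exact hasFDerivAt_fst.prodMk ((hasFDerivAt_const _ _).prodMk
        ((hasFDerivAt_fst.comp _ hasFDerivAt_snd).prodMk ((hasFDerivAt_const _ _).prodMk
          (hasFDerivAt_snd.comp _ hasFDerivAt_snd))))
    have hB' : HasFDerivAt B (((ContinuousLinearMap.fst ℝ Z (H × Y)) ∘L
        (ContinuousLinearMap.snd ℝ ℝ (Z × H × Y))) ∘L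
        ((e.symm : ℝ × W × Z2 × H2 × Y →L[ℝ] ℝ × Z × H × Y) ∘L ι3))
        (p₀.1, p₀.2.1, p₀.2.2.2) := by
      refine ((ContinuousLinearMap.fst ℝ Z (H × Y)) ∘L
        (ContinuousLinearMap.snd ℝ ℝ (Z × H × Y))).hasFDerivAt.comp (p₀.1, p₀.2.1, p₀.2.2.2)
        (f := fun q : ℝ × Z × Y =>
          Φ (lin ((q.1, 0, q.2.1, p₀.2.2.1, q.2.2) : ℝ × W × Z × H × Y))) ?_
      refine HasFDerivAt.comp (g := Φ) _ ?_ hι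
      have := hΦ0.hasFDerivAt
      rw [hq₀] at this
      exact this
    rw [hB'.fderiv]
    have h1 := e.apply_symm_apply (ι3 (0, x, 0))
    set δ := e.symm (ι3 (0, x, 0)) with hδ
    have h2 : dΨ p₀ δ = ι3 (0, x, 0) := h1
    have h3 : ι3 (0, x, 0) = (0, 0, π x, 0, 0) := by simp [ι3, lin]
    rw [h3, dΨ_apply] at h2
    simp only [Prod.mk.injEq] at h2
    refine ⟨δ.2.2.1, ?_⟩
    have h4 : ((0, δ.2.1, δ.2.2.1, 0) : ℝ × Z × H × Y) = δ :=
      Prod.ext h2.1.symm (Prod.ext rfl (Prod.ext rfl h2.2.2.2.2.symm))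
    change fderiv ℝ D p₀ (0, δ.2.1, δ.2.2.1, 0) = 0
    rw [h4]
    exact h2.2.1
  · filter_upwards [hleft] with p hp
    exact congrArg (fun q => q.2.1) hp
  · have hDd : ∀ᶠ p in 𝓝 p₀, DifferentiableAt ℝ D p := by
      filter_upwards [(hD.of_le (m := 1) (by exact_mod_cast le_top)).eventually (by simp)] with p hp
      exact hp.differentiableAt (by simp)
    have hΦd : ∀ᶠ q in 𝓝 (Ψ p₀), DifferentiableAt ℝ Φ q := by
      filter_upwards [(hΦs.of_le (m := 1) (by exact_mod_cast le_top)).eventually (by simp)]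
        with p hp
      exact hp.differentiableAt (by simp)
    have hΦc : Tendsto Φ (𝓝 (Ψ p₀)) (𝓝 p₀) := by
      have := hΦs.continuousAt.tendsto
      rwa [hΦp₀] at this
    let j : ℝ × Z × H × Y → ℝ × W × Z × H × Y := fun p => (p.1, 0, p.2.1, p.2.2.1, p.2.2.2)
    have hjc : Tendsto (fun p => lin (j p)) (𝓝 p₀) (𝓝 (Ψ p₀)) := by
      have : Continuous fun p => lin (j p) := by fun_prop
      have h := this.tendsto p₀
      rw [hq₀]
      exact h
    -- The point `p' = Φ (lin (j p))` lies on the zero set over `I`, exactly where the corank is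
    -- known to be constant.
    have hder : ∀ᶠ p in 𝓝 p₀, p.1 ∈ I →
        HasFDerivAt (fun h => G (p.1, 0, p.2.1, h, p.2.2.2)) (0 : H →L[ℝ] Z) p.2.2.1 := by
      filter_upwards [hjc.eventually (hΦc.eventually (hDd.and (hker.and hleft.eventually_nhds))),
        hjc.eventually (hright.and hΦd)] with p ⟨d1, k1, l1⟩ ⟨r1, d2⟩ hpI
      set p' := Φ (lin (j p)) with hp'
      have hp'1 : p'.1 = p.1 := congrArg (fun q => q.1) r1
      have hp'2 : D p' = 0 := congrArg (fun q => q.2.1) r1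
      have hfr := k1 (hp'1 ▸ hpI) hp'2
      have hid : ∀ v, fderiv ℝ Φ (lin (j p)) (dΨ p' v) = v := by
        intro v
        have a1 : HasFDerivAt Φ (fderiv ℝ Φ (lin (j p))) (Ψ p') := by
          rw [r1]; exact d2.hasFDerivAt
        have a2 := (a1.comp p' (hΨ p' d1))
        have a3 : HasFDerivAt (Φ ∘ Ψ) (ContinuousLinearMap.id ℝ _) p' :=
          (hasFDerivAt_id p').congr_of_eventuallyEq l1
        exact congrArg (fun L => L v) (a2.unique a3)
      set V := LinearMap.ker (fderiv ℝ D p' ∘L inclEta Z H Y).toLinearMap with hV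
      have hVmem : ∀ y, y ∈ V ↔ fderiv ℝ D p' (0, 0, y, 0) = 0 := fun y => Iff.rfl
      -- A kernel vector killed by `ρ` is killed by the derivative of `Ψ`, hence zero. With equal
      -- dimensions, `ρ` identifies the kernel at `p'` with `H2`.
      have hρinj : Function.Injective (ρ.toLinearMap ∘ₗ V.subtype) := by
        rw [← LinearMap.ker_eq_bot, LinearMap.ker_eq_bot']
        rintro ⟨y, hy⟩ hy0
        have hy0' : ρ y = 0 := hy0
        have b1 := hid (0, 0, y, 0)
        rw [dΨ_apply] at b1
        simp only [(hVmem y).1 hy, hy0', map_zero] at b1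
        have b2 : ((0, 0, 0, 0, 0) : ℝ × W × Z2 × H2 × Y) = 0 := rfl
        rw [b2, map_zero] at b1
        exact Subtype.ext (congrArg (fun q => q.2.2.1) b1).symm
      have hρsur := (LinearMap.injective_iff_surjective_of_finrank_eq_finrank hfr).1 hρinj
      have hΦat : HasFDerivAt Φ (fderiv ℝ Φ (lin (j p))) (lin (j p)) := d2.hasFDerivAt
      have hinner : HasFDerivAt (fun h : H =>
          lin ((p.1, 0, p.2.1, h, p.2.2.2) : ℝ × W × Z × H × Y))
          (lin ∘L ((0 : H →L[ℝ] ℝ).prod ((0 : H →L[ℝ] W).prod ((0 : H →L[ℝ] Z).prod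
            ((ContinuousLinearMap.id ℝ H).prod (0 : H →L[ℝ] Y))))))
          p.2.2.1 := by
        refine lin.hasFDerivAt.comp _ ?_
        exact (hasFDerivAt_const _ _).prodMk ((hasFDerivAt_const _ _).prodMk
          ((hasFDerivAt_const _ _).prodMk ((hasFDerivAt_id _).prodMk (hasFDerivAt_const _ _))))
      have hcomp := ((ContinuousLinearMap.fst ℝ Z (H × Y)) ∘L
        (ContinuousLinearMap.snd ℝ ℝ (Z × H × Y))).hasFDerivAt.comp p.2.2.1
          (HasFDerivAt.comp (g := Φ) p.2.2.1 hΦat hinner)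
      refine hcomp.congr_fderiv (ContinuousLinearMap.ext fun h => ?_)
      -- Changing `η` by `h` moves the chart coordinates just as a kernel vector `y` does, and
      -- moving along `y` leaves `z` fixed.
      obtain ⟨⟨y, hy⟩, hy'⟩ := hρsur (ρ h)
      have hy'' : ρ y = ρ h := hy'
      have b1 := hid (0, 0, y, 0)
      rw [dΨ_apply] at b1
      simp only [(hVmem y).1 hy, hy'', map_zero] at b1
      have b2 : (lin ((0, 0, 0, h, 0) : ℝ × W × Z × H × Y)) = (0, 0, 0, ρ h, 0) := by simp [lin]
      change (fderiv ℝ Φ (lin (j p)) (lin (0, 0, 0, h, 0))).2.1 = 0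
      rw [b2, b1]
    obtain ⟨ε, hε, hb⟩ := Metric.eventually_nhds_iff_ball.1 hder
    filter_upwards [Metric.ball_mem_nhds p₀ hε] with p hp hpI
    -- In the maximum norm the `η`-slice of a ball is a ball, so it is connected and a vanishing
    -- derivative in `η` gives constancy.
    have hball : ∀ h ∈ Metric.ball p₀.2.2.1 ε, HasFDerivAt
        (fun h => G (p.1, 0, p.2.1, h, p.2.2.2)) (0 : H →L[ℝ] Z) h := by
      intro h hh
      refine hb (p.1, p.2.1, h, p.2.2.2) ?_ hpI
      simp only [Metric.mem_ball, Prod.dist_eq, max_lt_iff] at hp hh ⊢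
      exact ⟨hp.1, hp.2.1, hh, hp.2.2.2⟩
    have hpη : p.2.2.1 ∈ Metric.ball p₀.2.2.1 ε := by
      simp only [Metric.mem_ball, Prod.dist_eq, max_lt_iff] at hp ⊢
      exact hp.2.2.1
    exact IsOpen.is_const_of_fderiv_eq_zero (𝕜 := ℝ) Metric.isOpen_ball
      (convex_ball _ _).isPreconnected
      (fun h hh => (hball h hh).differentiableAt.differentiableWithinAt)
      (fun h hh => (hball h hh).fderiv) hpη (Metric.mem_ball_self hε)

end Constraint

/-- An equation `E (x, v) = 0` whose derivative with respect to `v` is injective determines `v`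
as a smooth function of `x` and of the defect of the equation. -/
theorem exists_solution_of_injective {X V W : Type*} [NormedAddCommGroup X] [NormedSpace ℝ X]
    [NormedAddCommGroup V] [NormedSpace ℝ V] [NormedAddCommGroup W] [NormedSpace ℝ W]
    [FiniteDimensional ℝ X] [FiniteDimensional ℝ V] [FiniteDimensional ℝ W]
    {E : X × V → W} {x₀ : X} {v₀ : V} (hE : ContDiffAt ℝ ∞ E (x₀, v₀)) (hE0 : E (x₀, v₀) = 0)
    (hinj : ∀ v, fderiv ℝ E (x₀, v₀) (0, v) = 0 → v = 0) :
    ∃ K : X × W → V, ContDiffAt ℝ ∞ K (x₀, 0) ∧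
      ∀ᶠ q in 𝓝 (x₀, v₀), K (q.1, E q) = q.2 := by
  obtain ⟨g, hg⟩ := (fderiv ℝ E (x₀, v₀) ∘L ContinuousLinearMap.inr ℝ X V).toLinearMap
    |>.exists_leftInverse_of_injective (LinearMap.ker_eq_bot'.2 hinj)
  let L : W →L[ℝ] V := LinearMap.toContinuousLinearMap g
  have hL : ∀ v, L (fderiv ℝ E (x₀, v₀) (0, v)) = v := fun v => LinearMap.congr_fun hg v
  let Θ : X × V → X × V := fun q => (q.1, L (E q))
  let dΘ : X × V →L[ℝ] X × V :=
    (ContinuousLinearMap.fst ℝ X V).prod (L ∘L fderiv ℝ E (x₀, v₀))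
  have hsplit : ∀ ξ v, fderiv ℝ E (x₀, v₀) (ξ, v) =
      fderiv ℝ E (x₀, v₀) (ξ, 0) + fderiv ℝ E (x₀, v₀) (0, v) := by
    intro ξ v
    rw [← map_add]
    simp
  have hi : LinearMap.ker dΘ.toLinearMap = ⊥ := by
    rw [LinearMap.ker_eq_bot']
    rintro ⟨ξ, v⟩ h
    have h1 : ξ = 0 := congrArg Prod.fst h
    have h2 : L (fderiv ℝ E (x₀, v₀) (ξ, v)) = 0 := congrArg Prod.snd h
    rw [h1, hL] at h2
    rw [h1, h2]
    rfl
  have hs : LinearMap.range dΘ.toLinearMap = ⊤ := by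
    rw [LinearMap.range_eq_top]
    rintro ⟨ξ, v⟩
    refine ⟨(ξ, v - L (fderiv ℝ E (x₀, v₀) (ξ, 0))), ?_⟩
    change (ξ, L (fderiv ℝ E (x₀, v₀) (ξ, v - L (fderiv ℝ E (x₀, v₀) (ξ, 0))))) = (ξ, v)
    rw [hsplit, map_add, hL, add_sub_cancel]
  let e := ContinuousLinearEquiv.ofBijective dΘ hi hs
  have hΘ : ContDiffAt ℝ ∞ Θ (x₀, v₀) := contDiffAt_fst.prodMk (L.contDiff.contDiffAt.comp _ hE)
  have hΘ' : HasFDerivAt Θ (e : X × V →L[ℝ] X × V) (x₀, v₀) := by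
    have he : (e : X × V →L[ℝ] X × V) = dΘ := ContinuousLinearMap.ext fun v => rfl
    rw [he]
    exact hasFDerivAt_fst.prodMk
      (L.hasFDerivAt.comp _ (hE.differentiableAt (by simp)).hasFDerivAt)
  have hstr := hΘ.hasStrictFDerivAt' hΘ' (by simp)
  have hΞ : ContDiffAt ℝ ∞ (hstr.localInverse Θ e (x₀, v₀)) (Θ (x₀, v₀)) :=
    hΘ.to_localInverse hΘ' (by simp)
  have h0 : Θ (x₀, v₀) = (x₀, 0) := by simp [Θ, hE0]
  rw [h0] at hΞ
  refine ⟨fun q => (hstr.localInverse Θ e (x₀, v₀) (q.1, L q.2)).2, ?_, ?_⟩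
  · refine ContDiffAt.snd (ContDiffAt.comp (g := hstr.localInverse Θ e (x₀, v₀))
      (f := fun q : X × W => (q.1, L q.2)) _ ?_ (by fun_prop))
    simpa using hΞ
  · filter_upwards [hstr.eventually_left_inverse] with q hq
    exact congrArg Prod.snd hq

theorem hasDerivAt_jet {V : Type*} [NormedAddCommGroup V] [NormedSpace ℝ V] {k : ℕ}
    {f : ℝ → V} {t : ℝ} (hf : ContDiffAt ℝ (k + 1 : ℕ) f t) :
    HasDerivAt (jet k f) (jet k (deriv f) t) t := by
  refine hasDerivAt_pi.2 fun i => ?_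
  have h : ContDiffAt ℝ (1 : ℕ) (iteratedDeriv i f) t :=
    contDiffAt_iteratedDeriv (n := 1) i (hf.of_le (by have := i.2; norm_cast; omega))
  have h1 := (h.differentiableAt (by simp)).hasDerivAt
  rwa [← iteratedDeriv_succ, iteratedDeriv_succ'] at h1

/-! ### Hidden algebraic constraints along curves. -/

namespace ControlDAE

open Module

variable {ι κ : Type*} [Fintype ι] [Fintype κ] {S : ControlDAE ι κ} {T : ℝ}

theorem IsSmooth.smoothAt (hS : S.IsSmooth T) {t : ℝ} (ht : t ∈ Icc 0 T) {z v : ι → ℝ}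
    {u : κ → ℝ} (hz : z ∈ S.domZ) (hv : v ∈ S.domV) (hu : u ∈ S.domU) : S.SmoothAt ⊤ t z v u :=
  hS.2.2.2 t ht z hz v hv u hu

theorem IsSmooth.eventually_mem_dom (hS : S.IsSmooth T) {k : ℕ} {p₀ : JetSpace ι κ k}
    (h : p₀ ∈ S.solSet T k) :
    ∀ᶠ p in 𝓝 p₀, p.2.1 ∈ S.domZ ∧ p.2.2.1 0 ∈ S.domV ∧ p.2.2.2 0 ∈ S.domU := by
  obtain ⟨-, hz, hv, hu, -⟩ := h
  have c1 : Continuous fun p : JetSpace ι κ k => p.2.1 := by fun_prop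
  have c2 : Continuous fun p : JetSpace ι κ k => p.2.2.1 0 := by fun_prop
  have c3 : Continuous fun p : JetSpace ι κ k => p.2.2.2 0 := by fun_prop
  exact (c1.continuousAt.eventually_mem (hS.1.mem_nhds hz)).and
    ((c2.continuousAt.eventually_mem (hS.2.1.mem_nhds hv)).and
      (c3.continuousAt.eventually_mem (hS.2.2.1.mem_nhds hu)))

theorem arrayDerivEta_eq {k : ℕ} {p : JetSpace ι κ k} (h : DifferentiableAt ℝ (S.arrayFun k) p) :
    S.arrayDerivEta k p = fderiv ℝ (S.arrayFun k) p ∘L inclEta (ι → ℝ) (Fin (k + 1) → ι → ℝ)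
      (Fin (k + 1) → κ → ℝ) := by
  have h1 : HasFDerivAt (fun η => ((p.1, p.2.1, η, p.2.2.2) : JetSpace ι κ k))
      (inclEta (ι → ℝ) (Fin (k + 1) → ι → ℝ) (Fin (k + 1) → κ → ℝ)) p.2.2.1 :=
    (hasFDerivAt_const _ _).prodMk ((hasFDerivAt_const _ _).prodMk
      ((hasFDerivAt_id _).prodMk (hasFDerivAt_const _ _)))
  exact (h.hasFDerivAt.comp p.2.2.1 h1).fderiv

theorem arrayDerivZ_apply {k : ℕ} {p : JetSpace ι κ k} (h : DifferentiableAt ℝ (S.arrayFun k) p)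
    (x : ι → ℝ) : S.arrayDerivZ k p x = fderiv ℝ (S.arrayFun k) p (0, x, 0, 0) := by
  have h1 : HasFDerivAt (fun z => ((p.1, z, p.2.2.1, p.2.2.2) : JetSpace ι κ k))
      ((0 : (ι → ℝ) →L[ℝ] ℝ).prod ((ContinuousLinearMap.id ℝ (ι → ℝ)).prod
        (0 : (ι → ℝ) →L[ℝ] (Fin (k + 1) → ι → ℝ) × (Fin (k + 1) → κ → ℝ)))) p.2.1 :=
    (hasFDerivAt_const _ _).prodMk ((hasFDerivAt_id _).prodMk (hasFDerivAt_const _ _))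
  have h2 := (h.hasFDerivAt.comp p.2.1 h1).fderiv
  exact congrArg (fun L => L x) h2

theorem array_split {k : ℕ} {p : JetSpace ι κ k} (h : DifferentiableAt ℝ (S.arrayFun k) p)
    (x : ι → ℝ) (y : Fin (k + 1) → ι → ℝ) :
    fderiv ℝ (S.arrayFun k) p (0, x, y, 0) = S.arrayDerivZ k p x + S.arrayDerivEta k p y := by
  rw [arrayDerivZ_apply h, arrayDerivEta_eq h, ContinuousLinearMap.comp_apply, inclEta_apply,
    ← map_add]
  simp

/-- The algebraic constraints hidden in the derivative array, in solved form. -/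
theorem IsSmooth.exists_constraint (hT : 0 < T) (hS : S.IsSmooth T) {k : ℕ} {p₀ : JetSpace ι κ k}
    (hp₀ : p₀ ∈ S.solSet T k) (hreg : S.IsRegularAt T k p₀) :
    ∃ B : ℝ × (ι → ℝ) × (Fin (k + 1) → κ → ℝ) → (ι → ℝ),
      ContDiffAt ℝ ∞ B (p₀.1, p₀.2.1, p₀.2.2.2) ∧
      (∀ x, fderiv ℝ (fun v => S.F p₀.1 p₀.2.1 v (p₀.2.2.2 0)) (p₀.2.2.1 0) x = 0 →
        fderiv ℝ B (p₀.1, p₀.2.1, p₀.2.2.2) (0, x, 0) = x → x = 0) ∧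
      ∀ m : ℕ, ∀ᶠ p in 𝓝 p₀, ∀ (z : ℝ → ι → ℝ) (u : ℝ → κ → ℝ) (t : ℝ), t ∈ Icc 0 T →
        ContDiffAt ℝ ∞ z t → ContDiffAt ℝ ∞ u t → p = (t, z t, jet k (deriv z) t, jet k u t) →
        Flat (m + 1 + k) (S.residual z u) t →
        Flat (m + 1) (fun s => z s - B (s, z s, jet k u s)) t := by
  have hdom := hS.eventually_mem_dom hp₀
  have hsm : ∀ p : JetSpace ι κ k, p.1 ∈ Icc 0 T →
      (p.2.1 ∈ S.domZ ∧ p.2.2.1 0 ∈ S.domV ∧ p.2.2.2 0 ∈ S.domU) →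
      S.SmoothAt ⊤ p.1 p.2.1 (p.2.2.1 0) (p.2.2.2 0) :=
    fun p hp h => hS.smoothAt hp h.1 h.2.1 h.2.2
  have hDs : ContDiffAt ℝ ∞ (S.arrayFun k) p₀ :=
    contDiffAt_arrayFun (hsm p₀ hp₀.1 hdom.self_of_nhds)
  have hdiff : ∀ p : JetSpace ι κ k, p.1 ∈ Icc 0 T →
      (p.2.1 ∈ S.domZ ∧ p.2.2.1 0 ∈ S.domV ∧ p.2.2.2 0 ∈ S.domU) →
      DifferentiableAt ℝ (S.arrayFun k) p :=
    fun p hp h => (contDiffAt_arrayFun (hsm p hp h)).differentiableAt (by simp)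
  have hd₀ := hdiff p₀ hp₀.1 hdom.self_of_nhds
  obtain ⟨B, G, hB, hG, hBx, hGD, hGB⟩ := HybridDAE.exists_constraint (Icc 0 T) hDs hp₀.2.2.2.2
    (fun w => by
      obtain ⟨x, y, h⟩ := hreg.surjective w
      exact ⟨x, y, (array_split hd₀ x y).trans h⟩)
    (by
      filter_upwards [hdom, hreg.finrank_ker] with p h1 h2 h3 h4
      rw [← arrayDerivEta_eq hd₀, ← arrayDerivEta_eq (hdiff p h3 h1)]
      exact h2 ⟨h3, h1.1, h1.2.1, h1.2.2, h4⟩)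
  refine ⟨B, hB, fun x hx hBxx => ?_, fun m => ?_⟩
  -- A vector fixed by the `z`-derivative of `B` is itself a tangent `z`-direction, so regularity
  -- applies to it.
  · obtain ⟨y, hy⟩ := hBx x
    rw [hBxx, array_split hd₀] at hy
    exact hreg.eq_zero x y hy hx
  · let j₁ : JetSpace ι κ k → ℝ × (Fin (k + 1) → ι → ℝ) × (ι → ℝ) × (Fin (k + 1) → ι → ℝ) ×
      (Fin (k + 1) → κ → ℝ) := fun p => (p.1, 0, p.2.1, p.2.2.1, p.2.2.2)
    have hj₁ : Continuous j₁ := by fun_prop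
    let j₂ : JetSpace ι κ k → ℝ × (ι → ℝ) × (Fin (k + 1) → κ → ℝ) :=
      fun p => (p.1, p.2.1, p.2.2.2)
    have hj₂ : Continuous j₂ := by fun_prop
    have eG : ∀ᶠ p in 𝓝 p₀, ContDiffAt ℝ 1 G (j₁ p) :=
      (hj₁.tendsto p₀).eventually
        ((hG.of_le (m := 1) (by exact_mod_cast le_top)).eventually (by simp))
    -- Differentiability at a point spreads to a neighbourhood only for finite orders; therefore the
    -- neighbourhood depends on `m`.
    have eB : ∀ᶠ p in 𝓝 p₀, ContDiffAt ℝ (m + 1 : ℕ) B (j₂ p) :=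
      (hj₂.tendsto p₀).eventually
        ((hB.of_le (natCast_le_infty _)).eventually (natCast_ne_infty _))
    filter_upwards [hdom, eG, eB, hGD.eventually_nhds, hGB.eventually_nhds] with
      p hp hpG hpB hpD hpGB z u t ht hz hu hpt hflat
    let c : ℝ → JetSpace ι κ k := fun s => (s, z s, jet k (deriv z) s, jet k u s)
    have hz' : ContDiffAt ℝ ∞ (deriv z) t := hz.derivWithin (by simp)
    have hc : ContinuousAt c t :=
      continuousAt_id.prodMk (hz.continuousAt.prodMk
        ((contDiffAt_jet hz').continuousAt.prodMk (contDiffAt_jet hu).continuousAt))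
    have hct : Tendsto c (𝓝 t) (𝓝 p) := by
      have := hc.tendsto
      rwa [show c t = p from hpt.symm] at this
    have hpI : p.1 ∈ Icc 0 T := by rw [hpt]; exact ht
    have hSt : S.SmoothAt ⊤ t (z t) (deriv z t) (u t) := by
      have := hsm p hpI hp
      rw [hpt] at this
      simpa [jet] using this
    have hres : ContDiffAt ℝ ∞ (S.residual z u) t := contDiffAt_residual hSt hz hu
    have hflatj : Flat (m + 1) (jet k (S.residual z u)) t := by
      refine isBigO_pi.2 fun i => ?_
      have hi := i.2
      exact (hflat.mono (by omega : m + 1 + (i : ℕ) ≤ m + 1 + k)).iteratedDeriv (i : ℕ)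
        (hres.of_le (natCast_le_infty _))
    have hDj : ∀ᶠ s in 𝓝 t, S.arrayFun k (c s) = jet k (S.residual z u) s := by
      have e1 := (hz.of_le (natCast_le_infty (k + 2))).eventually (natCast_ne_infty _)
      have e2 := (hu.of_le (natCast_le_infty (k + 1))).eventually (natCast_ne_infty _)
      have hq : ContinuousAt (fun s => (s, z s, deriv z s, u s)) t :=
        continuousAt_id.prodMk (hz.continuousAt.prodMk
          (hz'.continuousAt.prodMk hu.continuousAt))
      have e3 := hq.tendsto.eventually
        ((ContDiffAt.of_le hSt (natCast_le_infty (k + 1))).eventually (natCast_ne_infty _))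
      filter_upwards [e1, e2, e3] with s h1 h2 h3
      exact derivArray_jet h3 h1 h2
    -- `z` is `G` evaluated with the true defect, the jet of the residual. Setting the defect to
    -- zero costs only the order to which that jet vanishes.
    have hGc : (fun s => z s - G (j₁ (c s))) =O[𝓝 t] fun s => (s - t) ^ (m + 1) := by
      let a : ℝ → ℝ × (Fin (k + 1) → ι → ℝ) × (ι → ℝ) × (Fin (k + 1) → ι → ℝ) ×
        (Fin (k + 1) → κ → ℝ) := fun s =>
          (s, jet k (S.residual z u) s, z s, jet k (deriv z) s, jet k u s)
      have h0 : jet k (S.residual z u) t = 0 := hflatj.eq_zero (by omega)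
      have ha : Tendsto a (𝓝 t) (𝓝 (j₁ p)) := by
        have h1 : ContinuousAt a t := continuousAt_id.prodMk
          ((contDiffAt_jet hres).continuousAt.prodMk (hc.snd))
        have h2 : a t = j₁ p := by
          rw [hpt]
          simp only [a, j₁, h0]
        rw [← h2]
        exact h1
      have hb : Tendsto (fun s => j₁ (c s)) (𝓝 t) (𝓝 (j₁ p)) := (hj₁.tendsto p).comp hct
      have h3 := isBigO_comp_sub_comp hpG ha hb
      have h4 : (fun s => a s - j₁ (c s)) =O[𝓝 t] fun s => (s - t) ^ (m + 1) := by
        have : (fun s => a s - j₁ (c s)) =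
            fun s => ((0 : ℝ), jet k (S.residual z u) s, (0 : ι → ℝ),
              (0 : Fin (k + 1) → ι → ℝ), (0 : Fin (k + 1) → κ → ℝ)) := by
          ext1 s
          simp [a, j₁, c]
          rfl
        rw [this]
        exact (isBigO_zero _ _).prod_left (hflatj.prod_left ((isBigO_zero _ _).prod_left
          ((isBigO_zero _ _).prod_left (isBigO_zero _ _))))
      refine (h3.trans h4).congr' ?_ EventuallyEq.rfl
      filter_upwards [hct.eventually hpD, hDj] with s h5 h6
      rw [h6] at h5
      change G (a s) - _ = _
      rw [show G (a s) = z s from h5]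
    refine flat_of_isBigO_within (accPt_principal_Icc hT ht) ?_ ?_
    · have hBt : ContDiffAt ℝ (m + 1 : ℕ) B (t, z t, jet k u t) := by
        have := hpB
        rw [hpt] at this
        exact this
      exact (hz.of_le (natCast_le_infty _)).sub (ContDiffAt.comp t
        (f := fun s => (s, z s, jet k u s)) hBt (contDiffAt_id.prodMk
          ((hz.of_le (natCast_le_infty _)).prodMk
            ((contDiffAt_jet hu).of_le (natCast_le_infty _)))))
    · refine (hGc.mono (inf_le_left : 𝓝[Icc 0 T] t ≤ 𝓝 t)).congr' ?_ EventuallyEq.rfl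
      filter_upwards [self_mem_nhdsWithin, (inf_le_left : 𝓝[Icc 0 T] t ≤ 𝓝 t)
        (hct.eventually hpGB)] with s hs h7
      rw [show G (j₁ (c s)) = B (s, z s, jet k u s) from h7 hs]

end ControlDAE

/-! ### The underlying differential equation of one subsystem. -/

namespace ControlDAE

variable {ι κ : Type*} [Fintype ι] [Fintype κ] {S : ControlDAE ι κ} {T : ℝ}

theorem jet_mem_solSet {k : ℕ} {z : ℝ → ι → ℝ} {u : ℝ → κ → ℝ} {t : ℝ} (hS : S.IsSmooth T)
    (ht : t ∈ Icc 0 T) (hz : ContDiffAt ℝ ∞ z t) (hu : ContDiffAt ℝ ∞ u t)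
    (hzd : z t ∈ S.domZ) (hvd : deriv z t ∈ S.domV) (hud : u t ∈ S.domU)
    (h : Flat (k + 1) (S.residual z u) t) :
    ((t, z t, jet k (deriv z) t, jet k u t) : JetSpace ι κ k) ∈ S.solSet T k := by
  have hSt := hS.smoothAt ht hzd hvd hud
  refine ⟨ht, hzd, by simpa [jet] using hvd, by simpa [jet] using hud, ?_⟩
  change S.derivArray k t (z t) (jet k (deriv z) t) (jet k u t) = 0
  rw [derivArray_jet (ContDiffAt.of_le hSt (natCast_le_infty _)) (hz.of_le (natCast_le_infty _))
    (hu.of_le (natCast_le_infty _))]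
  ext1 i
  exact h.iteratedDeriv_eq_zero ((contDiffAt_residual hSt hz hu).of_le (natCast_le_infty _)) i.2

/-- Under the strangeness hypothesis, the derivative of a curve which satisfies the system to high
order is, to the expected order, a smooth function of the time, the state and the derivatives of the
control. -/
theorem StrangenessHypothesis.exists_underlying_ode {μ : ℕ} (hT : 0 < T) (hS : S.IsSmooth T)
    (hμ : S.StrangenessHypothesis T μ) {z₀ : ℝ → ι → ℝ} {u₀ : ℝ → κ → ℝ} {t₀ : ℝ}
    (ht₀ : t₀ ∈ Icc 0 T) (hz₀ : ContDiffAt ℝ ∞ z₀ t₀) (hu₀ : ContDiffAt ℝ ∞ u₀ t₀)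
    (hzd : z₀ t₀ ∈ S.domZ) (hvd : deriv z₀ t₀ ∈ S.domV) (hud : u₀ t₀ ∈ S.domU)
    (hflat₀ : Flat (μ + 2) (S.residual z₀ u₀) t₀) (m : ℕ) :
    ∃ f : ℝ × (ι → ℝ) × (Fin (μ + 2) → κ → ℝ) → ι → ℝ,
      ContDiffAt ℝ ∞ f (t₀, z₀ t₀, jet (μ + 1) u₀ t₀) ∧
      ∀ᶠ q in 𝓝 (t₀, z₀ t₀, jet μ (deriv z₀) t₀, jet (μ + 1) u₀ t₀),
        ∀ (z : ℝ → ι → ℝ) (u : ℝ → κ → ℝ) (t : ℝ), t ∈ Icc 0 T →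
          ContDiffAt ℝ ∞ z t → ContDiffAt ℝ ∞ u t →
          q = (t, z t, jet μ (deriv z) t, jet (μ + 1) u t) →
          Flat (m + 2 + μ) (S.residual z u) t →
          Flat (m + 1) (fun s => deriv z s - f (s, z s, jet (μ + 1) u s)) t := by
  set p₀ : JetSpace ι κ μ := (t₀, z₀ t₀, jet μ (deriv z₀) t₀, jet μ u₀ t₀) with hp₀def
  have hp₀ : p₀ ∈ S.solSet T μ :=
    jet_mem_solSet hS ht₀ hz₀ hu₀ hzd hvd hud (hflat₀.mono (by omega))
  have hSt₀ := hS.smoothAt ht₀ hzd hvd hud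
  obtain ⟨B, hB, hBx, hBflat⟩ := hS.exists_constraint hT hp₀ (hμ.isRegularAt hp₀)
  change ContDiffAt ℝ ∞ B (t₀, z₀ t₀, jet μ u₀ t₀) at hB
  let init : (Fin (μ + 2) → κ → ℝ) → (Fin (μ + 1) → κ → ℝ) := fun υ i => υ i.castSucc
  let tail : (Fin (μ + 2) → κ → ℝ) → (Fin (μ + 1) → κ → ℝ) := fun υ i => υ i.succ
  have hinit : ContDiff ℝ ∞ init := by fun_prop
  have htail : ContDiff ℝ ∞ tail := by fun_prop
  have init_jet : ∀ (u : ℝ → κ → ℝ) s, init (jet (μ + 1) u s) = jet μ u s := fun u s => rfl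
  have tail_jet : ∀ (u : ℝ → κ → ℝ) s, tail (jet (μ + 1) u s) = jet μ (deriv u) s := by
    intro u s
    ext1 i
    simp [tail, jet, iteratedDeriv_succ']
  have jet_zero : ∀ (k : ℕ) (u : ℝ → κ → ℝ) s, jet k u s 0 = u s := fun k u s => by simp [jet]
  -- The time derivative of `z - B` with `ż` as a free variable. It involves one further derivative
  -- of the control, hence `Fin (μ + 2)`.
  let N : (ℝ × (ι → ℝ) × (Fin (μ + 2) → κ → ℝ)) × (ι → ℝ) → (ι → ℝ) := fun q =>
    q.2 - fderiv ℝ B (q.1.1, q.1.2.1, init q.1.2.2) (1, q.2, tail q.1.2.2)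
  let E : (ℝ × (ι → ℝ) × (Fin (μ + 2) → κ → ℝ)) × (ι → ℝ) → (ι → ℝ) × (ι → ℝ) := fun q =>
    (S.F q.1.1 q.1.2.1 q.2 (q.1.2.2 0), N q)
  have hdg : ∀ (z : ℝ → ι → ℝ) (u : ℝ → κ → ℝ) (t : ℝ), ContDiffAt ℝ (1 : ℕ) z t →
      ContDiffAt ℝ (μ + 1 : ℕ) u t → DifferentiableAt ℝ B (t, z t, jet μ u t) →
      HasDerivAt (fun s => z s - B (s, z s, jet μ u s))
        (N ((t, z t, jet (μ + 1) u t), deriv z t)) t := by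
    intro z u t hz hu hBt
    have h1 := (hz.differentiableAt (by simp)).hasDerivAt
    have h2 := hasDerivAt_jet (k := μ) hu
    have h3 := hBt.hasFDerivAt.comp_hasDerivAt t ((hasDerivAt_id t).prodMk (h1.prodMk h2))
    have h4 := h1.sub h3
    simp only [N, init_jet, tail_jet]
    exact h4
  set x₀ : ℝ × (ι → ℝ) × (Fin (μ + 2) → κ → ℝ) := (t₀, z₀ t₀, jet (μ + 1) u₀ t₀) with hx₀
  have hE : ContDiffAt ℝ ∞ E (x₀, deriv z₀ t₀) := by
    have h1 : ContDiffAt ℝ ∞ (fun q : (ℝ × (ι → ℝ) × (Fin (μ + 2) → κ → ℝ)) × (ι → ℝ) =>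
        S.F q.1.1 q.1.2.1 q.2 (q.1.2.2 0)) (x₀, deriv z₀ t₀) := by
      refine ContDiffAt.comp
        (g := fun q : ℝ × (ι → ℝ) × (ι → ℝ) × (κ → ℝ) => S.F q.1 q.2.1 q.2.2.1 q.2.2.2)
        (f := fun q : (ℝ × (ι → ℝ) × (Fin (μ + 2) → κ → ℝ)) × (ι → ℝ) =>
          (q.1.1, q.1.2.1, q.2, q.1.2.2 0)) _ ?_ (by fun_prop)
      simpa [hx₀, jet, SmoothAt] using hSt₀
    have h2 : ContDiffAt ℝ ∞ (fun q : (ℝ × (ι → ℝ) × (Fin (μ + 2) → κ → ℝ)) × (ι → ℝ) =>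
        fderiv ℝ B (q.1.1, q.1.2.1, init q.1.2.2)) (x₀, deriv z₀ t₀) := by
      refine ContDiffAt.comp (g := fderiv ℝ B)
        (f := fun q : (ℝ × (ι → ℝ) × (Fin (μ + 2) → κ → ℝ)) × (ι → ℝ) =>
          (q.1.1, q.1.2.1, init q.1.2.2)) _ ?_ (by fun_prop)
      exact hB.fderiv_right (by simp)
    exact h1.prodMk (contDiffAt_snd.sub (h2.clm_apply (by fun_prop)))
  have hBd : DifferentiableAt ℝ B (t₀, z₀ t₀, jet μ u₀ t₀) := hB.differentiableAt (by simp)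
  have hE0 : E (x₀, deriv z₀ t₀) = 0 := by
    have h1 : S.F t₀ (z₀ t₀) (deriv z₀ t₀) (u₀ t₀) = 0 := hflat₀.eq_zero (by omega)
    -- Order `μ + 2` of the residual leaves order `2` for the constraint, just enough for its first
    -- derivative to vanish at `t₀`.
    have h2 := (hBflat 1).self_of_nhds z₀ u₀ t₀ ht₀ hz₀ hu₀ rfl (hflat₀.mono (by omega))
    have hg : ContDiffAt ℝ (2 : ℕ) (fun s => z₀ s - B (s, z₀ s, jet μ u₀ s)) t₀ :=
      ContDiffAt.of_le (n := ∞) (hz₀.sub (ContDiffAt.comp t₀ (f := fun s => (s, z₀ s, jet μ u₀ s))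
        hB (contDiffAt_id.prodMk (hz₀.prodMk (contDiffAt_jet hu₀))))) (natCast_le_infty _)
    have h3 := h2.iteratedDeriv_eq_zero hg (i := 1) (by omega)
    rw [iteratedDeriv_one, (hdg z₀ u₀ t₀ (hz₀.of_le (natCast_le_infty _)) (hu₀.of_le (natCast_le_infty _)) hBd).deriv] at h3
    simp only [E, hx₀, jet_zero]
    rw [h1, h3]
    rfl
  have hinj : ∀ v, fderiv ℝ E (x₀, deriv z₀ t₀) (0, v) = 0 → v = 0 := by
    intro v hv
    have hFv : DifferentiableAt ℝ (fun v => S.F t₀ (z₀ t₀) v (u₀ t₀)) (deriv z₀ t₀) := by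
      refine ContDiffAt.differentiableAt (n := ∞) (ContDiffAt.comp
        (g := fun q : ℝ × (ι → ℝ) × (ι → ℝ) × (κ → ℝ) => S.F q.1 q.2.1 q.2.2.1 q.2.2.2)
        (f := fun v : ι → ℝ => (t₀, z₀ t₀, v, u₀ t₀)) _ hSt₀ (by fun_prop)) (by simp)
    let dB := fderiv ℝ B (t₀, z₀ t₀, jet μ u₀ t₀)
    have hin : HasFDerivAt (fun v : ι → ℝ => ((1 : ℝ), v, tail (jet (μ + 1) u₀ t₀)))
        ((0 : (ι → ℝ) →L[ℝ] ℝ).prod ((ContinuousLinearMap.id ℝ (ι → ℝ)).prod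
          (0 : (ι → ℝ) →L[ℝ] (Fin (μ + 1) → κ → ℝ)))) (deriv z₀ t₀) :=
      (hasFDerivAt_const _ _).prodMk ((hasFDerivAt_id _).prodMk (hasFDerivAt_const _ _))
    have h1 := hFv.hasFDerivAt.prodMk ((hasFDerivAt_id (deriv z₀ t₀)).sub
      (dB.hasFDerivAt.comp _ hin))
    have h2 := (hE.differentiableAt (by simp)).hasFDerivAt.comp (deriv z₀ t₀)
      ((hasFDerivAt_const x₀ _).prodMk (hasFDerivAt_id (deriv z₀ t₀)))
    have h3 : (E ∘ fun v : ι → ℝ => (x₀, v)) = fun v =>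
        (S.F t₀ (z₀ t₀) v (u₀ t₀), v - dB (1, v, tail (jet (μ + 1) u₀ t₀))) := by
      ext1 v
      simp only [E, N, hx₀, Function.comp, jet_zero, init_jet, dB]
    have h4 := congrArg (fun L => L v) ((h3 ▸ h2).unique h1)
    have h5 : ((fderiv ℝ (fun v => S.F t₀ (z₀ t₀) v (u₀ t₀)) (deriv z₀ t₀) v,
        v - dB (0, v, 0)) : (ι → ℝ) × (ι → ℝ)) = 0 := h4.symm.trans hv
    rw [Prod.mk_eq_zero] at h5
    refine hBx v ?_ (sub_eq_zero.1 h5.2).symm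
    simpa [hp₀def, jet] using h5.1
  obtain ⟨K, hK, hKE⟩ := exists_solution_of_injective hE hE0 hinj
  -- `K` recovers `ż` from the data and the defect of `E`; the underlying equation drops the defect,
  -- which is small along the curves considered.
  refine ⟨fun x => K (x, 0), ContDiffAt.comp (g := K) (f := fun x => (x, 0)) _ hK (by fun_prop), ?_⟩
  let Q := ℝ × (ι → ℝ) × (Fin (μ + 1) → ι → ℝ) × (Fin (μ + 2) → κ → ℝ)
  let π₁ : Q → JetSpace ι κ μ := fun q => (q.1, q.2.1, q.2.2.1, init q.2.2.2)
  let π₂ : Q → (ℝ × (ι → ℝ) × (Fin (μ + 2) → κ → ℝ)) × (ι → ℝ) :=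
    fun q => ((q.1, q.2.1, q.2.2.2), q.2.2.1 0)
  let q₀ : Q := (t₀, z₀ t₀, jet μ (deriv z₀) t₀, jet (μ + 1) u₀ t₀)
  have hπ₁ : Continuous π₁ := by fun_prop
  have hπ₂ : Continuous π₂ := by fun_prop
  have t₁ : Tendsto π₁ (𝓝 q₀) (𝓝 p₀) := hπ₁.tendsto q₀
  have t₂ : Tendsto π₂ (𝓝 q₀) (𝓝 (x₀, deriv z₀ t₀)) := by
    have := hπ₂.tendsto q₀
    simpa [π₂, q₀, jet] using this
  have t₃ : Tendsto (fun q : Q => (q.1, q.2.1, init q.2.2.2)) (𝓝 q₀)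
      (𝓝 (t₀, z₀ t₀, jet μ u₀ t₀)) :=
    (by fun_prop : Continuous fun q : Q => (q.1, q.2.1, init q.2.2.2)).tendsto q₀
  have t₄ : Tendsto (fun q : Q => ((q.1, q.2.1, q.2.2.2), (0 : (ι → ℝ) × (ι → ℝ)))) (𝓝 q₀)
      (𝓝 (x₀, 0)) :=
    (by fun_prop : Continuous fun q : Q =>
      ((q.1, q.2.1, q.2.2.2), (0 : (ι → ℝ) × (ι → ℝ)))).tendsto q₀
  have eB : ∀ᶠ q in 𝓝 q₀, ContDiffAt ℝ (m + 2 : ℕ) B (q.1, q.2.1, init q.2.2.2) :=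
    t₃.eventually ((hB.of_le (natCast_le_infty _)).eventually (natCast_ne_infty _))
  have eK : ∀ᶠ q in 𝓝 q₀, ContDiffAt ℝ (1 : ℕ) K ((q.1, q.2.1, q.2.2.2), 0) :=
    t₄.eventually ((hK.of_le (natCast_le_infty _)).eventually (natCast_ne_infty _))
  -- The constraint is used with `m + 1` because one order is lost on differentiating it.
  filter_upwards [t₁.eventually (hBflat (m + 1)), t₂.eventually hKE.eventually_nhds, eB, eK] with
    q hq1 hq2 hqB hqK z u t ht hz hu hqt hflat
  have hg := hq1 z u t ht hz hu (by rw [hqt]; rfl) (hflat.mono (by omega))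
  rw [hqt] at hqB hqK hq2
  change ContDiffAt ℝ (m + 2 : ℕ) B (t, z t, jet μ u t) at hqB
  have hz' : ContDiffAt ℝ ∞ (deriv z) t := hz.derivWithin (by simp)
  have hgs : ContDiffAt ℝ (m + 2 : ℕ) (fun s => z s - B (s, z s, jet μ u s)) t :=
    (hz.of_le (natCast_le_infty _)).sub (ContDiffAt.comp t (f := fun s => (s, z s, jet μ u s))
      hqB (ContDiffAt.of_le (n := ∞) (contDiffAt_id.prodMk (hz.prodMk (contDiffAt_jet hu)))
        (natCast_le_infty _)))
  have hg' := hg.deriv hgs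
  let e : ℝ → (ℝ × (ι → ℝ) × (Fin (μ + 2) → κ → ℝ)) × (ι → ℝ) :=
    fun s => ((s, z s, jet (μ + 1) u s), deriv z s)
  have he : ContinuousAt e t := (continuousAt_id.prodMk (hz.continuousAt.prodMk
    (contDiffAt_jet hu).continuousAt)).prodMk hz'.continuousAt
  have hN : ∀ᶠ s in 𝓝 t, deriv (fun s => z s - B (s, z s, jet μ u s)) s = N (e s) := by
    have hc : ContinuousAt (fun s => (s, z s, jet μ u s)) t :=
      continuousAt_id.prodMk (hz.continuousAt.prodMk (contDiffAt_jet hu).continuousAt)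
    filter_upwards [hc.eventually (hqB.eventually (natCast_ne_infty _)),
      (hz.of_le (natCast_le_infty 1)).eventually (natCast_ne_infty _),
      (hu.of_le (natCast_le_infty (μ + 1))).eventually (natCast_ne_infty _)] with s h1 h2 h3
    exact (hdg z u s h2 h3 (h1.differentiableAt (by simp))).deriv
  have hEe : Flat (m + 1) (fun s => E (e s)) t := by
    refine IsBigO.prod_left ?_ (hg'.congr' hN EventuallyEq.rfl)
    refine (hflat.mono (by omega : m + 1 ≤ m + 2 + μ)).congr' ?_ EventuallyEq.rfl
    filter_upwards with s
    simp only [residual, e, jet_zero]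
  have hEt : Tendsto (fun s => E (e s)) (𝓝 t) (𝓝 0) := by
    refine IsBigO.trans_tendsto hEe ?_
    have : Continuous fun s : ℝ => (s - t) ^ (m + 1) := by fun_prop
    simpa using this.tendsto t
  have h1 := isBigO_comp_sub_comp (by exact_mod_cast hqK) (he.fst.tendsto.prodMk_nhds hEt)
    (he.fst.tendsto.prodMk_nhds tendsto_const_nhds)
  have h2 : (fun s => ((e s).1, E (e s)) - ((e s).1, 0)) =O[𝓝 t] fun s => (s - t) ^ (m + 1) := by
    have : (fun s => ((e s).1, E (e s)) - ((e s).1, 0)) =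
        fun s => ((0 : ℝ × (ι → ℝ) × (Fin (μ + 2) → κ → ℝ)), E (e s)) := by
      ext1 s
      simp
    rw [this]
    exact (isBigO_zero _ _).prod_left hEe
  refine (h1.trans h2).congr' ?_ EventuallyEq.rfl
  have het : e t = π₂ (t, z t, jet μ (deriv z) t, jet (μ + 1) u t) := by
    simp [e, π₂, jet]
  change ∀ᶠ x in 𝓝 (π₂ (t, z t, jet μ (deriv z) t, jet (μ + 1) u t)), K (x.1, E x) = x.2 at hq2
  rw [← het] at hq2
  filter_upwards [he.eventually hq2] with s hs
  rw [hs]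

end ControlDAE

/-! ### Derivatives of an output along an approximate solution of an ODE. -/

section Lie

variable {P Z V : Type*} [NormedAddCommGroup P] [NormedSpace ℝ P] [NormedAddCommGroup Z]
  [NormedSpace ℝ Z] [NormedAddCommGroup V] [NormedSpace ℝ V]

/-- The iterated total derivative of `g (t, z)` along `ż = h (t, z)`. -/
noncomputable def lieIter (h : ℝ × Z → Z) (g : ℝ × Z → V) : ℕ → ℝ × Z → V
  | 0 => g
  | i + 1 => fun q => fderiv ℝ (lieIter h g i) q (1, h q)

theorem contDiffAt_lieIter_uncurry {h : P → ℝ × Z → Z} {g : ℝ × Z → V} {p : P} {q : ℝ × Z}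
    (hh : ContDiffAt ℝ ∞ (Function.uncurry h) (p, q)) (hg : ContDiffAt ℝ ∞ g q) (i : ℕ) :
    ContDiffAt ℝ ∞ (fun x : P × (ℝ × Z) => lieIter (h x.1) g i x.2) (p, q) := by
  induction i with
  | zero => exact ContDiffAt.comp (g := g) (f := Prod.snd) (p, q) hg contDiffAt_snd
  | succ i ih =>
    have h1 : ContDiffAt ℝ ∞ (fun x : P × (ℝ × Z) => fderiv ℝ (lieIter (h x.1) g i) x.2)
        (p, q) := by
      refine ContDiffAt.fderiv (n := ∞) (f := fun x : P × (ℝ × Z) => lieIter (h x.1) g i) ?_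
        contDiffAt_snd (by simp)
      exact ContDiffAt.comp (((p, q), q) : (P × (ℝ × Z)) × (ℝ × Z))
        (f := fun x : (P × (ℝ × Z)) × (ℝ × Z) => (x.1.1, x.2)) ih (by fun_prop)
    exact h1.clm_apply (contDiffAt_const.prodMk hh)

theorem contDiffAt_lieIter {h : ℝ × Z → Z} {g : ℝ × Z → V} {q : ℝ × Z} {n : ℕ} (i : ℕ)
    (hh : ContDiffAt ℝ (n + i : ℕ) h q) (hg : ContDiffAt ℝ (n + i : ℕ) g q) :
    ContDiffAt ℝ n (lieIter h g i) q := by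
  induction i generalizing n with
  | zero => exact hg
  | succ i ih =>
    have h1 : ContDiffAt ℝ (n + 1 : ℕ) (lieIter h g i) q :=
      ih (by rwa [add_assoc, add_comm 1 i]) (by rwa [add_assoc, add_comm 1 i])
    exact (h1.fderiv_right (by norm_cast)).clm_apply
      (contDiffAt_const.prodMk (hh.of_le (by norm_cast; omega)))

/-- Each differentiation loses one order and adds an error linear in `ż - h`, which is small to
order `m`. There is no error at `i = 0`, so the initial order may be taken as `m + 1`. -/
theorem flat_iteratedDeriv_sub_lieIter {h : ℝ × Z → Z} {g : ℝ × Z → V} {z : ℝ → Z} {t : ℝ} {m : ℕ}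
    (hz : ContDiffAt ℝ ∞ z t) (hh : ContDiffAt ℝ (m + 1 : ℕ) h (t, z t))
    (hg : ContDiffAt ℝ (m + 1 : ℕ) g (t, z t)) (hflat : Flat m (fun s => deriv z s - h (s, z s)) t)
    (i j : ℕ) (hij : i + j = m + 1) :
    Flat j (fun s => iteratedDeriv i (fun s => g (s, z s)) s - lieIter h g i (s, z s)) t := by
  have hγ : ContDiffAt ℝ ∞ (fun s => (s, z s)) t := contDiffAt_id.prodMk hz
  induction i generalizing j with
  | zero => simpa [lieIter] using isBigO_zero _ _
  | succ i ih =>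
    have h1 := ih (j + 1) (by omega)
    have cL : ContDiffAt ℝ (j + 1 : ℕ) (lieIter h g i) (t, z t) :=
      contDiffAt_lieIter i (hh.of_le (by norm_cast; omega)) (hg.of_le (by norm_cast; omega))
    have cLγ : ContDiffAt ℝ (j + 1 : ℕ) (fun s => lieIter h g i (s, z s)) t :=
      ContDiffAt.comp t (f := fun s => (s, z s)) cL (hγ.of_le (natCast_le_infty _))
    have cg : ContDiffAt ℝ (m + 1 : ℕ) (fun s => g (s, z s)) t :=
      ContDiffAt.comp t (f := fun s => (s, z s)) hg (hγ.of_le (natCast_le_infty _))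
    have cI : ContDiffAt ℝ (j + 1 : ℕ) (iteratedDeriv i fun s => g (s, z s)) t :=
      contDiffAt_iteratedDeriv (n := (j + 1 : ℕ)) i (cg.of_le (by norm_cast; omega))
    have h2 := h1.deriv (cI.sub cLγ)
    have cdL : ContinuousAt (fun s => fderiv ℝ (lieIter h g i) (s, z s)) t :=
      ContinuousAt.comp (f := fun s => (s, z s))
        (cL.fderiv_right (m := (j : ℕ)) (by norm_cast)).continuousAt hγ.continuousAt
    have h3 : Flat j (fun s => fderiv ℝ (lieIter h g i) (s, z s) (0, deriv z s - h (s, z s))) t := by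
      have h4 : (fun s => ((0 : ℝ), deriv z s - h (s, z s))) =O[𝓝 t] fun s => (s - t) ^ m :=
        (isBigO_zero _ _).prod_left hflat
      have h5 : (fun s => fderiv ℝ (lieIter h g i) (s, z s)) =O[𝓝 t] fun _ => (1 : ℝ) :=
        cdL.tendsto.isBigO_one ℝ
      have h6 := (h5.norm_left.mul h4.norm_left)
      simp only [one_mul] at h6
      refine Flat.mono (m := m) (IsBigO.trans (IsBigO.of_norm_le fun s => ?_) h6) (by omega)
      exact ContinuousLinearMap.le_opNorm _ _
    refine (h2.add h3).congr' ?_ EventuallyEq.rfl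
    filter_upwards [hγ.continuousAt.eventually (cL.eventually (natCast_ne_infty _)),
      cI.eventually (natCast_ne_infty _),
      (hz.of_le (natCast_le_infty 1)).eventually (natCast_ne_infty _)] with s d1 d2 d3
    have e1 := (d1.differentiableAt (by simp)).hasFDerivAt.comp_hasDerivAt s
      ((hasDerivAt_id s).prodMk (d3.differentiableAt (by simp)).hasDerivAt)
    have e2 := ((d2.differentiableAt (by simp)).hasDerivAt.sub e1).deriv
    have e3 : deriv (fun s => iteratedDeriv i (fun s => g (s, z s)) s - lieIter h g i (s, z s)) s =
        deriv (iteratedDeriv i fun s => g (s, z s)) s -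
          fderiv ℝ (lieIter h g i) (s, z s) (1, deriv z s) := e2
    rw [e3, iteratedDeriv_succ]
    simp only [lieIter]
    have e4 : ((1, deriv z s) : ℝ × Z) = (1, h (s, z s)) + (0, deriv z s - h (s, z s)) := by simp
    rw [e4, map_add]
    abel

theorem iteratedDeriv_eq_lieIter {h : ℝ × Z → Z} {g : ℝ × Z → V} {z : ℝ → Z} {t : ℝ} {m : ℕ}
    (hz : ContDiffAt ℝ ∞ z t) (hh : ContDiffAt ℝ (m + 1 : ℕ) h (t, z t))
    (hg : ContDiffAt ℝ (m + 1 : ℕ) g (t, z t)) (hflat : Flat m (fun s => deriv z s - h (s, z s)) t)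
    {i : ℕ} (hi : i ≤ m) :
    iteratedDeriv i (fun s => g (s, z s)) t = lieIter h g i (t, z t) :=
  sub_eq_zero.1 ((flat_iteratedDeriv_sub_lieIter hz hh hg hflat i (m + 1 - i) (by omega)).eq_zero
    (by omega))

end Lie

/-! ### The shifted hybrid system: smoothness and consistency. -/

section Hybrid

open ControlDAE

variable {ι₁ ι₂ κ₁ κ₂ : Type*}

theorem contDiff_comp_right [Fintype ι₁] [Fintype ι₂] (e : ι₁ → ι₂) {n : WithTop ℕ∞} :
    ContDiff ℝ n fun z : ι₂ → ℝ => z ∘ e :=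
  contDiff_pi.2 fun i => contDiff_apply ℝ ℝ (e i)

theorem deriv_comp_right [Fintype ι₁] [Fintype ι₂] (e : ι₁ → ι₂) {z : ℝ → ι₂ → ℝ} {t : ℝ}
    (hz : DifferentiableAt ℝ z t) : deriv (fun s => z s ∘ e) t = deriv z t ∘ e := by
  refine HasDerivAt.deriv (hasDerivAt_pi.2 fun i => ?_)
  exact hasDerivAt_pi.1 hz.hasDerivAt (e i)

variable [Fintype ι₁] [Fintype ι₂] [Fintype κ₁] [Fintype κ₂] {τ T : ℝ}
  {S₁ : ControlDAE ι₁ κ₁} {S₂ : ControlDAE ι₂ κ₂}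
  {G₁ : ℝ → (ι₁ → ℝ) → κ₂ → ℝ} {G₂ : ℝ → (ι₂ → ℝ) → κ₁ → ℝ}

theorem sub_mem_Icc (hτ : 0 < τ) {t : ℝ} (ht : t ∈ Icc 0 T) : t - τ ∈ Icc (-τ) T :=
  ⟨by linarith [ht.1], by linarith [ht.2]⟩

theorem contDiffAt_output₂ {t : ℝ} {x : ι₂ → ℝ}
    (hG : ContDiffAt ℝ ∞ (fun q : ℝ × (ι₂ → ℝ) => G₂ q.1 q.2) (t - τ, x)) :
    ContDiffAt ℝ ∞ (fun q : ℝ × (ι₂ → ℝ) => G₂ (q.1 - τ) q.2) (t, x) :=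
  ContDiffAt.comp (g := fun q : ℝ × (ι₂ → ℝ) => G₂ q.1 q.2)
    (f := fun q : ℝ × (ι₂ → ℝ) => (q.1 - τ, q.2)) (t, x) hG (by fun_prop)

theorem shiftedHybrid_isSmooth (hτ : 0 < τ) (hS₁ : S₁.IsSmooth T) (hS₂ : S₂.IsSmooth T)
    (hG₁ : IsOutputMap (Icc 0 T) S₁.domZ S₂.domU G₁)
    (hG₂ : IsOutputMap (Icc (-τ) T) S₂.domZ S₁.domU G₂) :
    (shiftedHybrid τ S₁ S₂ G₁ G₂).IsSmooth T := by
  have cl : Continuous fun z : ι₁ ⊕ ι₂ → ℝ => z ∘ Sum.inl :=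
    (contDiff_comp_right (n := 0) Sum.inl).continuous
  have cr : Continuous fun z : ι₁ ⊕ ι₂ → ℝ => z ∘ Sum.inr :=
    (contDiff_comp_right (n := 0) Sum.inr).continuous
  refine ⟨(hS₁.1.preimage cl).inter (hS₂.1.preimage cr),
    (hS₁.2.1.preimage cl).inter (hS₂.2.1.preimage cr),
    (hS₁.1.preimage cl).inter (hS₂.1.preimage cr), ?_⟩
  intro t ht z hz v hv x hx
  have hl : ContDiff ℝ ∞ fun z : ι₁ ⊕ ι₂ → ℝ => z ∘ Sum.inl := contDiff_comp_right Sum.inl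
  have hr : ContDiff ℝ ∞ fun z : ι₁ ⊕ ι₂ → ℝ => z ∘ Sum.inr := contDiff_comp_right Sum.inr
  obtain ⟨g1, m1⟩ := hG₁ t ht _ hz.1
  obtain ⟨g2, m2⟩ := hG₂ (t - τ) (sub_mem_Icc hτ ht) _ hx.2
  let R := ℝ × (ι₁ ⊕ ι₂ → ℝ) × (ι₁ ⊕ ι₂ → ℝ) × (ι₁ ⊕ ι₂ → ℝ)
  have p1 : ContDiff ℝ ∞ fun q : R => q.2.1 ∘ Sum.inl := hl.comp (by fun_prop)
  have p2 : ContDiff ℝ ∞ fun q : R => q.2.1 ∘ Sum.inr := hr.comp (by fun_prop)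
  have p3 : ContDiff ℝ ∞ fun q : R => q.2.2.1 ∘ Sum.inl :=
    hl.comp (f := fun q : R => q.2.2.1) (by fun_prop)
  have p4 : ContDiff ℝ ∞ fun q : R => q.2.2.1 ∘ Sum.inr :=
    hr.comp (f := fun q : R => q.2.2.1) (by fun_prop)
  have p5 : ContDiff ℝ ∞ fun q : R => q.2.2.2 ∘ Sum.inr :=
    hr.comp (f := fun q : R => q.2.2.2) (by fun_prop)
  have c1 : ContDiffAt ℝ ∞ (fun q : R => G₂ (q.1 - τ) (q.2.2.2 ∘ Sum.inr)) (t, z, v, x) :=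
    ContDiffAt.comp (g := fun q : ℝ × (ι₂ → ℝ) => G₂ (q.1 - τ) q.2)
      (f := fun q : R => (q.1, q.2.2.2 ∘ Sum.inr)) (t, z, v, x) (contDiffAt_output₂ g2)
      (contDiffAt_fst.prodMk p5.contDiffAt)
  have c2 : ContDiffAt ℝ ∞ (fun q : R => G₁ q.1 (q.2.1 ∘ Sum.inl)) (t, z, v, x) :=
    ContDiffAt.comp (g := fun q : ℝ × (ι₁ → ℝ) => G₁ q.1 q.2)
      (f := fun q : R => (q.1, q.2.1 ∘ Sum.inl)) (t, z, v, x) g1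
      (contDiffAt_fst.prodMk p1.contDiffAt)
  have d1 := ContDiffAt.comp
    (f := fun q : R => (q.1, q.2.1 ∘ Sum.inl, q.2.2.1 ∘ Sum.inl, G₂ (q.1 - τ) (q.2.2.2 ∘ Sum.inr)))
    (t, z, v, x) (hS₁.2.2.2 t ht _ hz.1 _ hv.1 _ m2)
    (contDiffAt_fst.prodMk (p1.contDiffAt.prodMk (p3.contDiffAt.prodMk c1)))
  have d2 := ContDiffAt.comp
    (f := fun q : R => (q.1, q.2.1 ∘ Sum.inr, q.2.2.1 ∘ Sum.inr, G₁ q.1 (q.2.1 ∘ Sum.inl)))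
    (t, z, v, x) (hS₂.2.2.2 t ht _ hz.2 _ hv.2 _ m1)
    (contDiffAt_fst.prodMk (p2.contDiffAt.prodMk (p4.contDiffAt.prodMk c2)))
  refine contDiffAt_pi.2 fun i => ?_
  rcases i with i | i
  · exact contDiffAt_pi.1 d1 i
  · exact contDiffAt_pi.1 d2 i

/-- The delayed output drives the first subsystem, and the output of its solution drives the second.
The jet of the combined solution is then a zero of every array. -/
theorem shiftedHybrid_isConsistentAt (hT : 0 < T) (hτ : 0 < τ) (hS₁ : S₁.IsSmooth T)
    (hS₂ : S₂.IsSmooth T) (hG₁ : IsOutputMap (Icc 0 T) S₁.domZ S₂.domU G₁)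
    (hG₂ : IsOutputMap (Icc (-τ) T) S₂.domZ S₁.domU G₂) (h₁ : S₁.IsSolvable T)
    (h₂ : S₂.IsSolvable T) (k : ℕ) : (shiftedHybrid τ S₁ S₂ G₁ G₂).IsConsistentAt T k := by
  intro x hx
  obtain ⟨z₁, hz₁⟩ := h₁ (fun s => G₂ (s - τ) (x s ∘ Sum.inr)) fun t ht => by
    obtain ⟨g, m⟩ := hG₂ (t - τ) (sub_mem_Icc hτ ht) _ (hx t ht).2.2
    exact ⟨ContDiffAt.comp t (f := fun s => (s, x s ∘ Sum.inr)) (contDiffAt_output₂ g)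
      (contDiffAt_id.prodMk ((contDiff_comp_right Sum.inr).contDiffAt.comp t (hx t ht).1)), m⟩
  obtain ⟨z₂, hz₂⟩ := h₂ (fun s => G₁ s (z₁ s)) fun t ht => by
    obtain ⟨g, m⟩ := hG₁ t ht _ (hz₁ t ht).2.1
    exact ⟨ContDiffAt.comp t (f := fun s => (s, z₁ s)) g (contDiffAt_id.prodMk (hz₁ t ht).1), m⟩
  have hsm : ∀ t ∈ Icc 0 T, ContDiffAt ℝ ∞ (fun s => Sum.elim (z₁ s) (z₂ s)) t := by
    intro t ht
    refine contDiffAt_pi.2 fun i => ?_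
    rcases i with i | i
    · exact contDiffAt_pi.1 (hz₁ t ht).1 i
    · exact contDiffAt_pi.1 (hz₂ t ht).1 i
  have hd₁ : ∀ t ∈ Icc 0 T, deriv (fun s => Sum.elim (z₁ s) (z₂ s)) t ∘ Sum.inl = deriv z₁ t :=
    fun t ht => (deriv_comp_right Sum.inl ((hsm t ht).differentiableAt (by simp))).symm
  have hd₂ : ∀ t ∈ Icc 0 T, deriv (fun s => Sum.elim (z₁ s) (z₂ s)) t ∘ Sum.inr = deriv z₂ t :=
    fun t ht => (deriv_comp_right Sum.inr ((hsm t ht).differentiableAt (by simp))).symm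
  -- An interior time, so that the residual vanishes on a full neighbourhood.
  have ht : T / 2 ∈ Icc 0 T := ⟨by linarith, by linarith⟩
  refine ⟨T / 2, Sum.elim (z₁ (T / 2)) (z₂ (T / 2)),
    jet k (deriv fun s => Sum.elim (z₁ s) (z₂ s)) (T / 2), ?_⟩
  refine jet_mem_solSet (z := fun s => Sum.elim (z₁ s) (z₂ s)) (u := x)
    (shiftedHybrid_isSmooth hτ hS₁ hS₂ hG₁ hG₂) ht (hsm _ ht) (hx _ ht).1
    ⟨(hz₁ _ ht).2.1, (hz₂ _ ht).2.1⟩ ⟨?_, ?_⟩ (hx _ ht).2 ?_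
  · rw [hd₁ _ ht]; exact (hz₁ _ ht).2.2.1
  · rw [hd₂ _ ht]; exact (hz₂ _ ht).2.2.1
  · refine (isBigO_zero _ _).congr' ?_ EventuallyEq.rfl
    filter_upwards [Icc_mem_nhds (by linarith : 0 < T / 2) (by linarith : T / 2 < T)] with s hs
    symm
    simp only [ControlDAE.residual, shiftedHybrid, hd₁ s hs, hd₂ s hs]
    ext i
    rcases i with i | i
    · exact congrFun (hz₁ s hs).2.2.2 i
    · exact congrFun (hz₂ s hs).2.2.2 i

end Hybrid

/-! ### The index bound. -/

section Index

set_option linter.unusedSectionVars false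

open ControlDAE

variable {ι₁ ι₂ κ₁ κ₂ : Type*} [Fintype ι₁] [Fintype ι₂] [Fintype κ₁] [Fintype κ₂] {τ T : ℝ}
  {S₁ : ControlDAE ι₁ κ₁} {S₂ : ControlDAE ι₂ κ₂}
  {G₁ : ℝ → (ι₁ → ℝ) → κ₂ → ℝ} {G₂ : ℝ → (ι₂ → ℝ) → κ₁ → ℝ} {k : ℕ}

theorem contDiff_stateCurve {ι κ : Type*} [Fintype ι] [Fintype κ] (p : JetSpace ι κ k) :
    ContDiff ℝ ∞ (stateCurve p) :=
  contDiff_jetCurve _ _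

theorem stateCurve_self {ι κ : Type*} [Fintype ι] [Fintype κ] (p : JetSpace ι κ k) :
    stateCurve p p.1 = p.2.1 := by
  simp [stateCurve, jetCurve_self]

theorem deriv_stateCurve_self {ι κ : Type*} [Fintype ι] [Fintype κ] (p : JetSpace ι κ k) :
    deriv (stateCurve p) p.1 = p.2.2.1 0 := by
  change deriv (jetCurve p.1 (Fin.cons p.2.1 p.2.2.1 : Fin (k + 2) → ι → ℝ)) p.1 = _
  rw [deriv_jetCurve_cons, jetCurve_self]

theorem residual_shiftedHybrid {z x : ℝ → ι₁ ⊕ ι₂ → ℝ} {s : ℝ} (hz : DifferentiableAt ℝ z s) :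
    (shiftedHybrid τ S₁ S₂ G₁ G₂).residual z x s = Sum.elim
      (S₁.residual (fun s => z s ∘ Sum.inl) (fun s => G₂ (s - τ) (x s ∘ Sum.inr)) s)
      (S₂.residual (fun s => z s ∘ Sum.inr) (fun s => G₁ s (z s ∘ Sum.inl)) s) := by
  simp only [ControlDAE.residual, shiftedHybrid]
  rw [deriv_comp_right Sum.inl hz, deriv_comp_right Sum.inr hz]

/-- Passes from a zero of the hybrid array to one curve per subsystem: the hybrid residual is the
pair of subsystem residuals, so both inherit the order `k + 1`. -/
theorem flat_residual_shiftedHybrid (hS : (shiftedHybrid τ S₁ S₂ G₁ G₂).IsSmooth T)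
    {p : JetSpace (ι₁ ⊕ ι₂) (ι₁ ⊕ ι₂) k} (hp : p ∈ (shiftedHybrid τ S₁ S₂ G₁ G₂).solSet T k) :
    Flat (k + 1) (S₁.residual (fun s => stateCurve p s ∘ Sum.inl)
      (fun s => G₂ (s - τ) (jetCurve p.1 p.2.2.2 s ∘ Sum.inr))) p.1 ∧
    Flat (k + 1) (S₂.residual (fun s => stateCurve p s ∘ Sum.inr)
      (fun s => G₁ s (stateCurve p s ∘ Sum.inl))) p.1 := by
  obtain ⟨ht, hz, hv, hx, h0⟩ := hp
  have hsm := hS.smoothAt ht hz hv hx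
  have hres : ContDiffAt ℝ ∞ ((shiftedHybrid τ S₁ S₂ G₁ G₂).residual (stateCurve p)
      (jetCurve p.1 p.2.2.2)) p.1 := by
    refine contDiffAt_residual ?_ (contDiff_stateCurve p).contDiffAt
      (contDiff_jetCurve _ _).contDiffAt
    rwa [stateCurve_self, deriv_stateCurve_self, jetCurve_self]
  have hflat : Flat (k + 1) ((shiftedHybrid τ S₁ S₂ G₁ G₂).residual (stateCurve p)
      (jetCurve p.1 p.2.2.2)) p.1 :=
    flat_of_iteratedDeriv_eq_zero (hres.of_le (natCast_le_infty _))
      fun i hi => congrFun h0 ⟨i, hi⟩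
  have heq : (shiftedHybrid τ S₁ S₂ G₁ G₂).residual (stateCurve p) (jetCurve p.1 p.2.2.2) = _ :=
    funext fun s => residual_shiftedHybrid
      ((contDiff_stateCurve p).contDiffAt.differentiableAt (by simp))
  rw [heq] at hflat
  exact ⟨isBigO_pi.2 fun i => isBigO_pi.1 hflat (Sum.inl i),
    isBigO_pi.2 fun i => isBigO_pi.1 hflat (Sum.inr i)⟩

theorem contDiffAt_jet_param {P V : Type*} [NormedAddCommGroup P] [NormedSpace ℝ P]
    [NormedAddCommGroup V] [NormedSpace ℝ V] {H : P → ℝ → V} {p : P} {t : ℝ} (m : ℕ)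
    (hH : ContDiffAt ℝ ∞ (Function.uncurry H) (p, t)) :
    ContDiffAt ℝ ∞ (fun q : P × ℝ => jet m (H q.1) q.2) (p, t) :=
  contDiffAt_pi.2 fun i => contDiffAt_uncurry_iteratedDeriv i hH

theorem contDiffAt_jet_deriv_param {P V : Type*} [NormedAddCommGroup P] [NormedSpace ℝ P]
    [NormedAddCommGroup V] [NormedSpace ℝ V] {H : P → ℝ → V} {p : P} {t : ℝ} (m : ℕ)
    (hH : ContDiffAt ℝ ∞ (Function.uncurry H) (p, t)) :
    ContDiffAt ℝ ∞ (fun q : P × ℝ => jet m (deriv (H q.1)) q.2) (p, t) :=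
  contDiffAt_pi.2 fun i => by
    simp only [jet, ← iteratedDeriv_succ']
    exact contDiffAt_uncurry_iteratedDeriv _ hH

theorem contDiffAt_slice {P V : Type*} [NormedAddCommGroup P] [NormedSpace ℝ P]
    [NormedAddCommGroup V] [NormedSpace ℝ V] {H : P → ℝ → V} {p : P} {t : ℝ} {n : WithTop ℕ∞}
    (h : ContDiffAt ℝ n (Function.uncurry H) (p, t)) : ContDiffAt ℝ n (H p) t :=
  ContDiffAt.comp t (f := fun s => (p, s)) h (contDiffAt_const.prodMk contDiffAt_id)

theorem shiftedHybrid_determinesDerivative (hT : 0 < T) (hτ : 0 < τ) (hS₁ : S₁.IsSmooth T)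
    (hS₂ : S₂.IsSmooth T) (hG₁ : IsOutputMap (Icc 0 T) S₁.domZ S₂.domU G₁)
    (hG₂ : IsOutputMap (Icc (-τ) T) S₂.domZ S₁.domU G₂) {μ₁ μ₂ : ℕ}
    (h₁ : S₁.StrangenessHypothesis T μ₁) (h₂ : S₂.StrangenessHypothesis T μ₂) :
    (shiftedHybrid τ S₁ S₂ G₁ G₂).DeterminesDerivative T (μ₁ + μ₂ + 1) := by
  have hS := shiftedHybrid_isSmooth hτ hS₁ hS₂ hG₁ hG₂
  intro p₀ hp₀
  let J := JetSpace (ι₁ ⊕ ι₂) (ι₁ ⊕ ι₂) (μ₁ + μ₂ + 1)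
  let X := Fin (μ₁ + μ₂ + 1 + 1) → ι₁ ⊕ ι₂ → ℝ
  let z₁ : J → ℝ → ι₁ → ℝ := fun p s => stateCurve p s ∘ Sum.inl
  let z₂ : J → ℝ → ι₂ → ℝ := fun p s => stateCurve p s ∘ Sum.inr
  -- This control depends on the time and the control jet only, not on the state or `η`; this keeps
  -- the final formula free of `η`.
  let v₁ : ℝ × X → ℝ → κ₁ → ℝ := fun y s => G₂ (s - τ) (jetCurve y.1 y.2 s ∘ Sum.inr)
  let u₂ : J → ℝ → κ₂ → ℝ := fun p s => G₁ s (z₁ p s)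
  have smz₁ : ContDiff ℝ ∞ (Function.uncurry z₁) :=
    (contDiff_comp_right Sum.inl).comp (contDiff_stateCurve_uncurry _)
  have smz₂ : ContDiff ℝ ∞ (Function.uncurry z₂) :=
    (contDiff_comp_right Sum.inr).comp (contDiff_stateCurve_uncurry _)
  have z₁_self : ∀ p : J, z₁ p p.1 = p.2.1 ∘ Sum.inl := fun p => by
    simp only [z₁, stateCurve_self]
  have z₂_self : ∀ p : J, z₂ p p.1 = p.2.1 ∘ Sum.inr := fun p => by
    simp only [z₂, stateCurve_self]
  have dz₁_self : ∀ p : J, deriv (z₁ p) p.1 = p.2.2.1 0 ∘ Sum.inl := fun p => by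
    rw [← deriv_stateCurve_self]
    exact deriv_comp_right _ ((contDiff_stateCurve p).contDiffAt.differentiableAt (by simp))
  have dz₂_self : ∀ p : J, deriv (z₂ p) p.1 = p.2.2.1 0 ∘ Sum.inr := fun p => by
    rw [← deriv_stateCurve_self]
    exact deriv_comp_right _ ((contDiff_stateCurve p).contDiffAt.differentiableAt (by simp))
  have smv₁ : ∀ p ∈ (shiftedHybrid τ S₁ S₂ G₁ G₂).solSet T (μ₁ + μ₂ + 1),
      ContDiffAt ℝ ∞ (Function.uncurry v₁) ((p.1, p.2.2.2), p.1) ∧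
        v₁ (p.1, p.2.2.2) p.1 ∈ S₁.domU := by
    intro p hp
    obtain ⟨g, m⟩ := hG₂ (p.1 - τ) (sub_mem_Icc hτ hp.1) _ hp.2.2.2.1.2
    have e : jetCurve p.1 p.2.2.2 p.1 = p.2.2.2 0 := jetCurve_self _ _
    constructor
    · refine ContDiffAt.comp (f := fun q : (ℝ × X) × ℝ => (q.2, jetCurve q.1.1 q.1.2 q.2 ∘ Sum.inr))
        ((p.1, p.2.2.2), p.1) (g := fun q : ℝ × (ι₂ → ℝ) => G₂ (q.1 - τ) q.2) ?_ ?_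
      · simp only [e]
        exact contDiffAt_output₂ g
      · refine contDiffAt_snd.prodMk (ContDiff.contDiffAt ?_)
        exact (contDiff_comp_right Sum.inr).comp
          ((contDiff_jetCurve_uncurry (V := ι₁ ⊕ ι₂ → ℝ) _).comp
            (f := fun q : (ℝ × X) × ℝ => (q.1.1, q.1.2, q.2)) (by fun_prop))
    · simp only [v₁, e]
      exact m
  have smu₂ : ∀ p ∈ (shiftedHybrid τ S₁ S₂ G₁ G₂).solSet T (μ₁ + μ₂ + 1),
      ContDiffAt ℝ ∞ (Function.uncurry u₂) (p, p.1) ∧ u₂ p p.1 ∈ S₂.domU ∧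
        ContDiffAt ℝ ∞ (Function.uncurry G₁) (p.1, p.2.1 ∘ Sum.inl) := by
    intro p hp
    obtain ⟨g, m⟩ := hG₁ p.1 hp.1 _ hp.2.1.1
    refine ⟨?_, ?_, g⟩
    · refine ContDiffAt.comp (f := fun q : J × ℝ => (q.2, z₁ q.1 q.2)) (p, p.1)
        (g := fun q : ℝ × (ι₁ → ℝ) => G₁ q.1 q.2) ?_ (contDiffAt_snd.prodMk smz₁.contDiffAt)
      simp only [z₁_self]
      exact g
    · simp only [u₂, z₁_self]
      exact m
  have ht₀ := hp₀.1
  set y₀ : ℝ × X := (p₀.1, p₀.2.2.2) with hy₀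
  have curves : ∀ p ∈ (shiftedHybrid τ S₁ S₂ G₁ G₂).solSet T (μ₁ + μ₂ + 1),
      ContDiffAt ℝ ∞ (z₁ p) p.1 ∧ ContDiffAt ℝ ∞ (z₂ p) p.1 ∧
      ContDiffAt ℝ ∞ (v₁ (p.1, p.2.2.2)) p.1 ∧ ContDiffAt ℝ ∞ (u₂ p) p.1 := fun p hp =>
    ⟨contDiffAt_slice smz₁.contDiffAt, contDiffAt_slice smz₂.contDiffAt,
      contDiffAt_slice (smv₁ p hp).1, contDiffAt_slice (smu₂ p hp).1⟩
  have flats : ∀ p ∈ (shiftedHybrid τ S₁ S₂ G₁ G₂).solSet T (μ₁ + μ₂ + 1),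
      Flat (μ₁ + μ₂ + 1 + 1) (S₁.residual (z₁ p) (v₁ (p.1, p.2.2.2))) p.1 ∧
      Flat (μ₁ + μ₂ + 1 + 1) (S₂.residual (z₂ p) (u₂ p)) p.1 :=
    fun p hp => flat_residual_shiftedHybrid hS hp
  obtain ⟨c1, c2, c3, c4⟩ := curves p₀ hp₀
  obtain ⟨fl1, fl2⟩ := flats p₀ hp₀
  -- With `m = μ₂` the available order `μ₁ + μ₂ + 2` is used up exactly and leaves `ż₁ = f₁` valid
  -- to order `μ₂ + 1`. For the second subsystem `m = 0` suffices, since only the value of `ż₂` is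
  -- wanted.
  obtain ⟨f₁, hf₁, hA₁⟩ := h₁.exists_underlying_ode hT hS₁ ht₀ c1 c3
    (by rw [z₁_self]; exact hp₀.2.1.1) (by rw [dz₁_self]; exact hp₀.2.2.1.1) (smv₁ p₀ hp₀).2
    (fl1.mono (by omega)) μ₂
  obtain ⟨f₂, hf₂, hA₂⟩ := h₂.exists_underlying_ode hT hS₂ ht₀ c2 c4
    (by rw [z₂_self]; exact hp₀.2.1.2) (by rw [dz₂_self]; exact hp₀.2.2.1.2) (smu₂ p₀ hp₀).2.1
    (fl2.mono (by omega)) 0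
  -- The base point `y` of the polynomial control stays fixed while the time in `q` varies, so Lie
  -- derivatives along `h` differentiate the control curve too.
  let h : ℝ × X → ℝ × (ι₁ → ℝ) → (ι₁ → ℝ) := fun y q => f₁ (q.1, q.2, jet (μ₁ + 1) (v₁ y) q.1)
  let J₂ : (ℝ × X) × ℝ × (ι₁ → ℝ) → (Fin (μ₂ + 2) → κ₂ → ℝ) := fun q i =>
    lieIter (h q.1) (Function.uncurry G₁) i q.2
  have smJ₁ : ContDiffAt ℝ ∞ (fun q : (ℝ × X) × ℝ => jet (μ₁ + 1) (v₁ q.1) q.2) (y₀, p₀.1) :=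
    contDiffAt_jet_param _ (smv₁ p₀ hp₀).1
  have smh : ContDiffAt ℝ ∞ (Function.uncurry h) (y₀, p₀.1, z₁ p₀ p₀.1) := by
    refine ContDiffAt.comp (y₀, p₀.1, z₁ p₀ p₀.1)
      (f := fun q : (ℝ × X) × ℝ × (ι₁ → ℝ) => (q.2.1, q.2.2, jet (μ₁ + 1) (v₁ q.1) q.2.1)) hf₁ ?_
    refine ContDiffAt.prodMk (by fun_prop) (ContDiffAt.prodMk (by fun_prop) ?_)
    exact ContDiffAt.comp (y₀, p₀.1, z₁ p₀ p₀.1)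
      (f := fun q : (ℝ × X) × ℝ × (ι₁ → ℝ) => (q.1, q.2.1)) smJ₁ (by fun_prop)
  have smG : ContDiffAt ℝ ∞ (Function.uncurry G₁) (p₀.1, z₁ p₀ p₀.1) := by
    rw [z₁_self]; exact (smu₂ p₀ hp₀).2.2
  have smJ₂ : ContDiffAt ℝ ∞ J₂ (y₀, p₀.1, z₁ p₀ p₀.1) :=
    contDiffAt_pi.2 fun i => contDiffAt_lieIter_uncurry smh smG i
  let e₁ : J → ℝ × (ι₁ → ℝ) × (Fin (μ₁ + 1) → ι₁ → ℝ) × (Fin (μ₁ + 2) → κ₁ → ℝ) := fun p =>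
    (p.1, z₁ p p.1, jet μ₁ (deriv (z₁ p)) p.1, jet (μ₁ + 1) (v₁ (p.1, p.2.2.2)) p.1)
  let e₂ : J → ℝ × (ι₂ → ℝ) × (Fin (μ₂ + 1) → ι₂ → ℝ) × (Fin (μ₂ + 2) → κ₂ → ℝ) := fun p =>
    (p.1, z₂ p p.1, jet μ₂ (deriv (z₂ p)) p.1, jet (μ₂ + 1) (u₂ p) p.1)
  let e₃ : J → (ℝ × X) × ℝ × (ι₁ → ℝ) := fun p => ((p.1, p.2.2.2), p.1, z₁ p p.1)
  have hdiag : ContinuousAt (fun p : J => (p, p.1)) p₀ := by fun_prop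
  have cz₁ : ContinuousAt (fun p : J => z₁ p p.1) p₀ :=
    ContinuousAt.comp (f := fun p : J => (p, p.1)) smz₁.contDiffAt.continuousAt hdiag
  have cz₂ : ContinuousAt (fun p : J => z₂ p p.1) p₀ :=
    ContinuousAt.comp (f := fun p : J => (p, p.1)) smz₂.contDiffAt.continuousAt hdiag
  have ce₁ : ContinuousAt e₁ p₀ := by
    refine continuousAt_fst.prodMk (cz₁.prodMk (ContinuousAt.prodMk ?_ ?_))
    · exact ContinuousAt.comp (f := fun p : J => (p, p.1))
        (contDiffAt_jet_deriv_param μ₁ smz₁.contDiffAt).continuousAt hdiag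
    · exact ContinuousAt.comp (f := fun p : J => (((p.1, p.2.2.2), p.1) : (ℝ × X) × ℝ))
        smJ₁.continuousAt (by fun_prop)
  have ce₂ : ContinuousAt e₂ p₀ := by
    refine continuousAt_fst.prodMk (cz₂.prodMk (ContinuousAt.prodMk ?_ ?_))
    · exact ContinuousAt.comp (f := fun p : J => (p, p.1))
        (contDiffAt_jet_deriv_param μ₂ smz₂.contDiffAt).continuousAt hdiag
    · exact ContinuousAt.comp (f := fun p : J => (p, p.1))
        (contDiffAt_jet_param (μ₂ + 1) (smu₂ p₀ hp₀).1).continuousAt hdiag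
  have ce₃ : ContinuousAt e₃ p₀ :=
    ContinuousAt.prodMk (by fun_prop) (continuousAt_fst.prodMk cz₁)
  have ev₁ := ce₁.eventually hA₁
  have ev₂ := ce₂.eventually hA₂
  have ev₃ := ce₃.eventually
    ((smh.of_le (natCast_le_infty (μ₂ + 1 + 1))).eventually (natCast_ne_infty _))
  have key : ∀ᶠ p in 𝓝 p₀, p ∈ (shiftedHybrid τ S₁ S₂ G₁ G₂).solSet T (μ₁ + μ₂ + 1) →
      deriv (z₁ p) p.1 = f₁ (p.1, z₁ p p.1, jet (μ₁ + 1) (v₁ (p.1, p.2.2.2)) p.1) ∧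
      deriv (z₂ p) p.1 = f₂ (p.1, z₂ p p.1, jet (μ₂ + 1) (u₂ p) p.1) ∧
      jet (μ₂ + 1) (u₂ p) p.1 = J₂ ((p.1, p.2.2.2), p.1, z₁ p p.1) := by
    filter_upwards [ev₁, ev₂, ev₃] with p hq₁ hq₂ hq₃ hp
    obtain ⟨d1, d2, d3, d4⟩ := curves p hp
    obtain ⟨l1, l2⟩ := flats p hp
    have r1 := hq₁ (z₁ p) (v₁ (p.1, p.2.2.2)) p.1 hp.1 d1 d3 rfl (l1.mono (by omega))
    have r2 := hq₂ (z₂ p) (u₂ p) p.1 hp.1 d2 d4 rfl (l2.mono (by omega))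
    refine ⟨sub_eq_zero.1 (r1.eq_zero (by omega)), sub_eq_zero.1 (r2.eq_zero (by omega)), ?_⟩
    ext1 i
    refine iteratedDeriv_eq_lieIter (h := h (p.1, p.2.2.2)) (g := Function.uncurry G₁) (z := z₁ p)
      (m := μ₂ + 1) d1 ?_ ?_ r1 (by omega)
    · exact ContDiffAt.comp (p.1, z₁ p p.1) (g := Function.uncurry h)
        (f := fun q : ℝ × (ι₁ → ℝ) => (((p.1, p.2.2.2), q) : (ℝ × X) × ℝ × (ι₁ → ℝ))) hq₃
        (contDiffAt_const.prodMk contDiffAt_id)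
    · rw [z₁_self]
      exact (smu₂ p hp).2.2.of_le (natCast_le_infty _)
  -- The smoothness of `f₂` is known at the jet of `u₂`; rewriting that jet as `J₂` expresses the
  -- base point through `t`, `z` and the control jet.
  have hbase := (key.self_of_nhds hp₀).2.2
  rw [hbase] at hf₂
  let Y := ℝ × (ι₁ ⊕ ι₂ → ℝ) × X
  refine ⟨_, key, fun q : Y => Sum.elim
    (f₁ (q.1, q.2.1 ∘ Sum.inl, jet (μ₁ + 1) (v₁ (q.1, q.2.2)) q.1))
    (f₂ (q.1, q.2.1 ∘ Sum.inr, J₂ ((q.1, q.2.2), q.1, q.2.1 ∘ Sum.inl))), ?_, ?_⟩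
  · have pl : ContDiff ℝ ∞ fun q : Y => q.2.1 ∘ Sum.inl :=
      (contDiff_comp_right Sum.inl).comp (by fun_prop)
    have pr : ContDiff ℝ ∞ fun q : Y => q.2.1 ∘ Sum.inr :=
      (contDiff_comp_right Sum.inr).comp (by fun_prop)
    have s1 : ContDiffAt ℝ ∞ (fun q : Y =>
        f₁ (q.1, q.2.1 ∘ Sum.inl, jet (μ₁ + 1) (v₁ (q.1, q.2.2)) q.1))
        (p₀.1, p₀.2.1, p₀.2.2.2) := by
      refine ContDiffAt.comp (p₀.1, p₀.2.1, p₀.2.2.2) (g := f₁)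
        (f := fun q : Y => (q.1, q.2.1 ∘ Sum.inl, jet (μ₁ + 1) (v₁ (q.1, q.2.2)) q.1)) ?_ ?_
      · rw [z₁_self] at hf₁
        exact hf₁
      · refine contDiffAt_fst.prodMk (pl.contDiffAt.prodMk ?_)
        exact ContDiffAt.comp (p₀.1, p₀.2.1, p₀.2.2.2)
          (f := fun q : Y => (((q.1, q.2.2), q.1) : (ℝ × X) × ℝ)) smJ₁ (by fun_prop)
    have s2 : ContDiffAt ℝ ∞ (fun q : Y =>
        f₂ (q.1, q.2.1 ∘ Sum.inr, J₂ ((q.1, q.2.2), q.1, q.2.1 ∘ Sum.inl)))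
        (p₀.1, p₀.2.1, p₀.2.2.2) := by
      rw [z₁_self] at hf₂ smJ₂
      rw [z₂_self] at hf₂
      refine ContDiffAt.comp (p₀.1, p₀.2.1, p₀.2.2.2) (g := f₂)
        (f := fun q : Y => (q.1, q.2.1 ∘ Sum.inr, J₂ ((q.1, q.2.2), q.1, q.2.1 ∘ Sum.inl))) hf₂ ?_
      refine contDiffAt_fst.prodMk (pr.contDiffAt.prodMk ?_)
      refine ContDiffAt.comp (p₀.1, p₀.2.1, p₀.2.2.2) (g := J₂)
        (f := fun q : Y => (((q.1, q.2.2), q.1, q.2.1 ∘ Sum.inl) : (ℝ × X) × ℝ × (ι₁ → ℝ))) smJ₂ ?_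
      exact ContDiffAt.prodMk (by fun_prop) (contDiffAt_fst.prodMk pl.contDiffAt)
    refine contDiffAt_pi.2 fun i => ?_
    rcases i with i | i
    · exact contDiffAt_pi.1 s1 i
    · exact contDiffAt_pi.1 s2 i
  · rintro p ⟨hp, hpk⟩
    obtain ⟨k1, k2, k3⟩ := hpk hp
    rw [k3, dz₂_self, z₂_self, z₁_self] at k2
    rw [dz₁_self, z₁_self] at k1
    ext i
    rcases i with i | i
    · exact congrFun k1 i
    · exact congrFun k2 i

theorem shiftedHybrid_hasDifferentiationIndex (hT : 0 < T) (hτ : 0 < τ) (hS₁ : S₁.IsSmooth T)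
    (hS₂ : S₂.IsSmooth T) (hG₁ : IsOutputMap (Icc 0 T) S₁.domZ S₂.domU G₁)
    (hG₂ : IsOutputMap (Icc (-τ) T) S₂.domZ S₁.domU G₂) {μ₁ μ₂ : ℕ}
    (h₁ : S₁.StrangenessHypothesis T μ₁) (h₂ : S₂.StrangenessHypothesis T μ₂) :
    ∃ ν ≤ μ₁ + μ₂ + 1, (shiftedHybrid τ S₁ S₂ G₁ G₂).HasDifferentiationIndex T ν := by
  have h := shiftedHybrid_determinesDerivative hT hτ hS₁ hS₂ hG₁ hG₂ h₁ h₂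
  exact ⟨sInf {k | (shiftedHybrid τ S₁ S₂ G₁ G₂).DeterminesDerivative T k}, Nat.sInf_le h,
    Nat.sInf_mem ⟨_, h⟩, fun _ hk => Nat.sInf_le hk⟩

end Index

end HybridDAE

theorem mainTheorem3 (n₁ n₂ m₁ m₂ : ℕ) (T τ : ℝ) (hT : 0 < T) (hτ : 0 < τ)
    (S₁ : HybridDAE.ControlDAE (Fin n₁) (Fin m₁)) (S₂ : HybridDAE.ControlDAE (Fin n₂) (Fin m₂))
    (G₁ : ℝ → (Fin n₁ → ℝ) → Fin m₂ → ℝ) (G₂ : ℝ → (Fin n₂ → ℝ) → Fin m₁ → ℝ)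
    (hS₁ : S₁.IsSmooth T) (hS₂ : S₂.IsSmooth T)
    (hG₁ : HybridDAE.IsOutputMap (Set.Icc 0 T) S₁.domZ S₂.domU G₁)
    (hG₂ : HybridDAE.IsOutputMap (Set.Icc (-τ) T) S₂.domZ S₁.domU G₂)
    (μ₁ μ₂ : ℕ)
    (h₁ : S₁.StrangenessHypothesis T μ₁) (h₂ : S₂.StrangenessHypothesis T μ₂) :
    (∃ ν : ℕ, ν ≤ μ₁ + μ₂ + 1 ∧
      (HybridDAE.shiftedHybrid τ S₁ S₂ G₁ G₂).HasDifferentiationIndex T ν) ∧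
    (S₁.IsSolvable T → S₂.IsSolvable T →
      ∀ k : ℕ, (HybridDAE.shiftedHybrid τ S₁ S₂ G₁ G₂).IsConsistentAt T k) := by
  exact ⟨HybridDAE.shiftedHybrid_hasDifferentiationIndex hT hτ hS₁ hS₂ hG₁ hG₂ h₁ h₂,
    fun s₁ s₂ => HybridDAE.shiftedHybrid_isConsistentAt hT hτ hS₁ hS₂ hG₁ hG₂ s₁ s₂⟩
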